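/- **Setting.** Let $d\ge 1$, let $\Lambda=(\mathbb R/\mathbb Z)^d$ with Lebesgue measure $\lambda$, and for $\gamma=1/n$ with $n$ an odd positive integer let $\Lambda_\gamma=\mathbb Z^d/n\mathbb Z^d$ and $\mathcal S_\gamma=\{-1,+1\}^{\Lambda_\gamma}$. Let $a_1,\dots,a_N\in\mathbb R$ be distinct, $p_i\ge 0$, $\sum_i p_i=1$, and let $\alpha=(\alpha(x))_{x\in\mathbb Z^d}$ be i.i.d. random variables on a probability space with probability $\mathbb P$, with $\mathbb P(\alpha(x)=a_i)=p_i$. The field on $\Lambda_\gamma$ is obtained by identifying $\Lambda_\gamma$ with $\{-\frac{n-1}2,\dots,\frac{n-1}2\}^d\subset\mathbb Z^d$. Let $J\in C^1(\Lambda)$ satisfy $J(-r)=J(r)$ and $\int_\Lambda J=1$, and let $\theta>0$. For $\sigma\in\mathcal S_\gamma$ put $$H^{\gamma,\alpha}(\sigma)=-\tfrac12\sum_{x,y\in\Lambda_\gamma}\gamma^dJ(\gamma(x-y))\sigma(x)\sigma(y)-\theta\sum_{x\in\Lambda_\gamma}\alpha(x)\sigma(x),$$ let $\sigma^x$ be $\sigma$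 with the spin at $x$ flipped, and $$c_x(\sigma)=\frac{\exp[-\frac12\Delta_x]}{2\cosh[\frac12\Delta_x]},\qquad \Delta_x=H^{\gamma,\alpha}(\sigma^x)-H^{\gamma,\alpha}(\sigma).$$ For $\sigma^\gamma\in\mathcal S_\gamma$ let $P^{\gamma,\alpha}_{\sigma^\gamma}$ be the law, on the space of right continuous paths with left limits $(\sigma_t)_{t\ge 0}$ in $\mathcal S_\gamma$, of the Markov process started from $\sigma^\gamma$ with generator $\mathcal L f(\sigma)=\sum_{x\in\Lambda_\gamma}c_x(\sigma)[f(\sigma^x)-f(\sigma)]$. Let $$\pi^\gamma(\sigma)=\gamma^d\sum_{x\in\Lambda_\gamma}\sigma(x)\delta_{\gamma x},\qquad \pi^\gamma_t=\pi^\gamma(\sigma_t),$$ write $\langle\mu,G\rangle=\int G\,d\mu$, fix a dense sequence $(H_k)_{k\ge 0}$ in the unit ball of $C(\Lambda)$, and let $\rho(\mu,\nu)=\sum_{k\ge 0}2^{-k}|\langle\mu-\nu,H_k\rangle|$, which metrizes the weak topology on the signed measures of total variation at most $1$. **Theorem.** Let $m_0:\Lambda\to[-1,1]$ be continuous and let $(\sigma^\gamma)_\gamma$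 be deterministic configurations with $\lim_{\gamma\to 0}\rho(\pi^\gamma(\sigma^\gamma),m_0\lambda)=0$. Then the problem $$\partial_t m(t,r)=-m(t,r)+\sum_{i=1}^N p_i\tanh\big[(J*m(t,\cdot))(r)+a_i\theta\big],\qquad m(0,\cdot)=m_0,$$ has a weak solution $m$ on $[0,\infty)\times\Lambda$, it is unique (up to $\lambda$-null sets, for every $t\ge0$) among measurable functions that are bounded in $L^\infty(\Lambda)$ locally uniformly in time, and $|m(t,\cdot)|\le 1$ $\lambda$-a.e. for every $t\ge 0$. Here $m$ is a weak solution if, for all continuous $G:\mathbb R\times\Lambda\to\mathbb R$ with continuous $\partial_tG$ and all $t\ge 0$, $$\int_\Lambda m(t,r)G(t,r)\,dr-\int_\Lambda m_0(r)G(0,r)\,dr-\int_0^t\!\!\int_\Lambda m\,\partial_sG\,dr\,ds=\int_0^t\!\!\int_\Lambda\Big(-m+\sum_i p_i\tanh[J*m+a_i\theta]\Big)G\,dr\,ds .$$ Moreover, for $\mathbb P$-almost every realization $\alpha$ of the field the following hold, with limits along $\gamma=1/n$, $n$ odd. 1. For all $t\ge 0$ and $\delta>0$, $\displaystyle\lim_{\gamma\to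 0}P^{\gamma,\alpha}_{\sigma^\gamma}\big[\rho(\pi^\gamma_t,m(t,\cdot)\lambda)\ge\delta\big]=0$. 2. For all $T>0$, all $G\in C^{0,1}([0,T]\times\Lambda)$ (continuous on $[0,T]\times\Lambda$, and continuously differentiable in the second variable) and all $\delta>0$, $$\lim_{\gamma\to 0}P^{\gamma,\alpha}_{\sigma^\gamma}\Big[\sup_{t\in[0,T]}\big|\langle\pi^\gamma_t,G(t,\cdot)\rangle-\langle m(t,\cdot)\lambda,G(t,\cdot)\rangle\big|\ge\delta\Big]=0 .$$ -/

import Mathlib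

open MeasureTheory ProbabilityTheory Filter Topology Set
open scoped NNReal ENNReal

noncomputable section

namespace KacGlauber

/-! ### The torus and the discrete torus -/

/-- The macroscopic space: the `d`-dimensional torus `(ℝ/ℤ)^d`. Its `volume` is Lebesgue measure,
of total mass one. -/
abbrev Torus (d : ℕ) : Type := Fin d → UnitAddCircle

/-- A function on the torus is continuously differentiable if its periodic lift to `ℝ^d` is. -/
def IsC1 {d : ℕ} (f : Torus d → ℝ) : Prop :=
  ContDiff ℝ 1 (fun v : Fin d → ℝ => f (fun i => (v i : UnitAddCircle)))

/-- Convolution on the torus, `(J * f)(r) = ∫ J(r - r') f(r') dr'`. -/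
def conv {d : ℕ} (J f : Torus d → ℝ) (r : Torus d) : ℝ :=
  ∫ r', J (r - r') * f r'

/-- The discrete torus `ℤ^d / nℤ^d`, where `n = γ⁻¹`. -/
abbrev Lattice (d n : ℕ) : Type := Fin d → ZMod n

/-- The macroscopic position `γ x` of the site `x`, where `γ = 1/n`. -/
def pos {d n : ℕ} [NeZero n] (x : Lattice d n) : Torus d :=
  fun i => ZMod.toAddCircle (x i)

/-- The representative of a site of the discrete torus in `ℤ^d` which is closest to the origin:
for odd `n` its coordinates lie in `{-(n-1)/2, …, (n-1)/2}`. -/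
def rep {d n : ℕ} (x : Lattice d n) : Fin d → ℤ :=
  fun i => (x i).valMinAbs

/-! ### Configurations, Hamiltonian, generator -/

/-- Spin configurations; `ℤˣ = {1, -1}`. -/
abbrev Config (d n : ℕ) : Type := Lattice d n → ℤˣ

/-- The value `±1` of the spin at `x`, as a real number. -/
def spin {d n : ℕ} (σ : Config d n) (x : Lattice d n) : ℝ := ((σ x : ℤ) : ℝ)

/-- The configuration `σ` with the spin at `x` flipped. -/
def flip {d n : ℕ} (σ : Config d n) (x : Lattice d n) : Config d n :=
  Function.update σ x (-σ x)

/-- The Kac potential `J_γ(x, y) = γ^d J(γ(x - y))`, where `γ = 1/n`. -/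
def kac {d n : ℕ} [NeZero n] (J : Torus d → ℝ) (x y : Lattice d n) : ℝ :=
  (1 / (n : ℝ)) ^ d * J (pos (x - y))

/-- The Hamiltonian, for the realization `α` of the field on `ℤ^d`. -/
def hamiltonian {d n : ℕ} [NeZero n] (J : Torus d → ℝ) (θ : ℝ) (α : (Fin d → ℤ) → ℝ)
    (σ : Config d n) : ℝ :=
  -(1 / 2) * ∑ x, ∑ y, kac J x y * spin σ x * spin σ y
    - θ * ∑ x, α (rep x) * spin σ x

/-- The rate at which the spin at `x` flips (inverse temperature one). -/
def rate {d n : ℕ} [NeZero n] (J : Torus d → ℝ) (θ : ℝ) (α : (Fin d → ℤ) → ℝ)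
    (x : Lattice d n) (σ : Config d n) : ℝ :=
  Real.exp (-(1 / 2) * (hamiltonian J θ α (flip σ x) - hamiltonian J θ α σ)) /
    (2 * Real.cosh ((1 / 2) * (hamiltonian J θ α (flip σ x) - hamiltonian J θ α σ)))

/-- The generator of the Glauber dynamics. -/
def generator {d n : ℕ} [NeZero n] (J : Torus d → ℝ) (θ : ℝ) (α : (Fin d → ℤ) → ℝ)
    (f : Config d n → ℝ) (σ : Config d n) : ℝ :=
  ∑ x, rate J θ α x σ * (f (flip σ x) - f σ)

/-! ### Path space and the law of the dynamics -/

/-- The space `D([0,∞), S)` of paths in the finite set of configurations that are right continuous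
with left limits. Its σ-algebra is generated by the coordinate maps. -/
def Path (d n : ℕ) : Type :=
  {w : ℝ≥0 → Config d n // (∀ t, ContinuousWithinAt w (Ici t) t) ∧
    ∀ t, ∃ η, Tendsto w (𝓝[<] t) (𝓝 η)}

/-- The configuration `σ_t` of a path at time `t`. -/
def Path.at {d n : ℕ} (w : Path d n) (t : ℝ≥0) : Config d n := w.1 t

instance {d n : ℕ} : MeasurableSpace (Path d n) :=
  ⨆ t : ℝ≥0, MeasurableSpace.comap (fun w : Path d n => w.at t) ⊤

/-- The canonical filtration on path space. -/
def canonicalFiltration (d n : ℕ) :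
    Filtration ℝ≥0 (inferInstance : MeasurableSpace (Path d n)) where
  seq t := ⨆ s : ℝ≥0, ⨆ _ : s ≤ t, MeasurableSpace.comap (fun w : Path d n => w.at s) ⊤
  mono' := fun _ _ hst => iSup_mono fun _ => iSup_mono' fun hu => ⟨hu.trans hst, le_rfl⟩
  le' := fun _ => iSup_mono fun _ => iSup_le fun _ => le_rfl

/-- `P` is the law on path space of the Glauber dynamics in the field `α` started from the
configuration `η`, i.e. the solution of the martingale problem for the generator. -/
structure IsGlauberLaw {d n : ℕ} [NeZero n] (J : Torus d → ℝ) (θ : ℝ) (α : (Fin d → ℤ) → ℝ)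
    (η : Config d n) (P : Measure (Path d n)) : Prop where
  isProbabilityMeasure : IsProbabilityMeasure P
  initial : ∀ᵐ w ∂P, w.at 0 = η
  martingale : ∀ f : Config d n → ℝ,
    Martingale (fun (t : ℝ≥0) (w : Path d n) => f (w.at t) - f (w.at 0) -
      ∫ s in (0 : ℝ)..t, generator J θ α f (w.at s.toNNReal)) (canonicalFiltration d n) P

/-! ### Measures on the torus -/

/-- The duality bracket `⟨μ, G⟩ = ∫ G dμ` between signed measures and functions. -/
def pairing {d : ℕ} (μ : SignedMeasure (Torus d)) (G : Torus d → ℝ) : ℝ :=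
  ∫ᵛ r, G r ∂<•μ

/-- `H` is a sequence which is dense in the unit ball of `C(Λ)`. -/
def IsDenseInUnitBall {d : ℕ} (H : ℕ → C(Torus d, ℝ)) : Prop :=
  (∀ k, ‖H k‖ ≤ 1) ∧ Metric.closedBall 0 1 ⊆ closure (range H)

/-- The distance that metrizes the weak topology on the signed measures of total variation at
most one, built on a dense sequence `H` of the unit ball of `C(Λ)`. -/
def rho {d : ℕ} (H : ℕ → C(Torus d, ℝ)) (μ ν : SignedMeasure (Torus d)) : ℝ :=
  ∑' k : ℕ, (1 / 2 : ℝ) ^ k * |pairing (μ - ν) (H k)|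

/-- The empirical measure `π^γ(σ) = γ^d ∑_x σ(x) δ_{γx}`, where `γ = 1/n`. -/
def empirical {d n : ℕ} [NeZero n] (σ : Config d n) : SignedMeasure (Torus d) :=
  (1 / (n : ℝ)) ^ d • ∑ x, spin σ x • (Measure.dirac (pos x)).toSignedMeasure

/-- The measure `f λ` with density `f` with respect to Lebesgue measure. -/
def density {d : ℕ} (f : Torus d → ℝ) : SignedMeasure (Torus d) :=
  (volume : Measure (Torus d)).withDensityᵥ f

/-! ### The limiting equation -/

/-- Weak solutions `m(t, r)`, `t ≥ 0`, of
`∂ₜ m = - m + ∑ᵢ pᵢ tanh (J * m + aᵢ θ)`, `m(0, ·) = m₀`, in the class of functions that are bounded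
in `L^∞(Λ)` locally uniformly in time. The test functions `G` are continuous on time × torus, with
a continuous time derivative `G'`. The values of `m` at negative times play no role. -/
structure IsWeakSolution {d N : ℕ} (J : Torus d → ℝ) (θ : ℝ) (a p : Fin N → ℝ)
    (m₀ : Torus d → ℝ) (m : ℝ → Torus d → ℝ) : Prop where
  measurable : Measurable (Function.uncurry m)
  bounded : ∀ T : ℝ, ∃ C : ℝ, ∀ t ∈ Icc 0 T, ∀ᵐ r, |m t r| ≤ C
  equation : ∀ G G' : ℝ → Torus d → ℝ,
    Continuous (Function.uncurry G) → Continuous (Function.uncurry G') →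
    (∀ t r, HasDerivAt (fun s => G s r) (G' t r) t) →
    ∀ t : ℝ, 0 ≤ t →
      (∫ r, m t r * G t r) - (∫ r, m₀ r * G 0 r) - (∫ s in (0 : ℝ)..t, ∫ r, m s r * G' s r) =
        ∫ s in (0 : ℝ)..t, ∫ r,
          (-m s r + ∑ i, p i * Real.tanh (conv J (m s) r + a i * θ)) * G s r

end KacGlauber

end

noncomputable section

namespace KacGlauber

/-! ### Elementary analysis -/

/-! Tested on a fixed function $G$, the empirical measure is its initial value plus a martingale
plus the time integral of the generator, and the generator almost closes: by `generator_avg` it is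
minus the empirical average plus the lattice mean of $\tanh(\text{local field})\,G$. The local field
is the empirical measure tested on $J(r-\cdot)$, plus $\theta\alpha$ and a self-interaction of order
$\gamma^d$. One flip moves the average by $O(\gamma^d)$, so the variance is $O(\gamma^d)$ and Doob's
inequality makes the martingale small uniformly on $[0,T]$ (`sum_rate_mul_sq_avg_le`,
`IsGlauberLaw.measure_exists_lt_mart_le`).

The disorder is removed by a quenched law of large numbers. Off one null set of fields,
$\gamma^d\sum_x 1\{\alpha(x)=a_i\}G(\gamma x)\to p_i\int G$ for every continuous $G$
(`ae_tendsto_fieldError`, by Hoeffding and Borel–Cantelli). It is applied to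
$\tanh(J*m(s)+a_i\theta)\,G$, which involves only the deterministic limit and ranges over a compact
set as $s\le T$ and $G$ in a compact set vary.

The comparison is a Grönwall argument for a whole family $S$ of test functions that contains every
$J(r-\cdot)$: since $\tanh$ is 1-Lipschitz, the drift error for each $G\in S$ is bounded by the
errors over $S$ itself (`abs_avgError_path_le`). Compactness of $S$ makes every estimate uniform.
The same Grönwall argument on a ball of $C(\Lambda)$, without noise, gives uniqueness
(`IsWeakSolution.ae_eq`). Existence is Picard–Lindelöf in $C(\Lambda)$ for $e^t m(t)$, and the bound
on that field also gives $|m|\le1$. Both modes of convergence come from suitable choices of $S$ in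
`tendsto_measure_exists_le_avgError`. -/

instance instIsProbabilityMeasureTorus (d : ℕ) :
    IsProbabilityMeasure (volume : Measure (Torus d)) := by
  have : IsProbabilityMeasure (volume : Measure UnitAddCircle) := ⟨by simp⟩
  rw [volume_pi]; infer_instance

theorem hasDerivAt_tanh (x : ℝ) : HasDerivAt Real.tanh (1 - Real.tanh x ^ 2) x := by
  have h := (Real.hasDerivAt_sinh x).div (Real.hasDerivAt_cosh x) (Real.cosh_pos x).ne'
  have e : Real.tanh = fun y => Real.sinh y / Real.cosh y := funext Real.tanh_eq_sinh_div_cosh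
  rw [e]
  have hc := (Real.cosh_pos x).ne'
  have e' : 1 - (Real.sinh x / Real.cosh x) ^ 2 =
      (Real.cosh x * Real.cosh x - Real.sinh x * Real.sinh x) / Real.cosh x ^ 2 := by
    field_simp
  simp only [e']
  exact h

theorem continuous_tanh : Continuous Real.tanh :=
  continuous_iff_continuousAt.2 fun x => (hasDerivAt_tanh x).continuousAt

theorem abs_tanh_sub_tanh_le (x y : ℝ) : |Real.tanh x - Real.tanh y| ≤ |x - y| := by
  have h := convex_univ.norm_image_sub_le_of_norm_hasDerivWithin_le (f := Real.tanh)
    (f' := fun x => 1 - Real.tanh x ^ 2) (C := 1) (x := y) (y := x)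
    (fun z _ => (hasDerivAt_tanh z).hasDerivWithinAt) (fun z _ => by
      have h1 := (abs_lt.1 (Real.abs_tanh_lt_one z))
      rw [Real.norm_eq_abs, abs_le]
      constructor <;> nlinarith) (mem_univ _) (mem_univ _)
  simpa using h

/-- A Grönwall inequality without any regularity in time. -/
theorem abs_le_of_forall_abs_le_exp {ι : Type*} {z : ℝ → ι → ℝ} {T C ε B : ℝ} (hC : 0 < C)
    (hε : 0 ≤ ε)
    (hB : ∀ t ∈ Icc 0 T, ∀ i, |z t i| ≤ B)
    (h : ∀ K : ℝ, 0 ≤ K → (∀ t ∈ Icc 0 T, ∀ i, |z t i| ≤ K * Real.exp (2 * C * t)) →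
      ∀ t ∈ Icc 0 T, ∀ i, |z t i| ≤ ε + ∫ s in (0 : ℝ)..t, C * K * Real.exp (2 * C * s))
    {t : ℝ} (ht : t ∈ Icc 0 T) (i : ι) : |z t i| ≤ 2 * ε * Real.exp (2 * C * T) := by
  -- The supremum with weight $e^{-2Ct}$ is finite by the a priori bound `hB`. The integral produces
  -- only half of it, so it can be absorbed.
  set S : Set ℝ := range fun q : Icc 0 T × ι => |z q.1 q.2| * Real.exp (-(2 * C * q.1)) with hS
  have hbdd : BddAbove S := by
    refine ⟨B, ?_⟩
    rintro _ ⟨⟨⟨s, hs⟩, j⟩, rfl⟩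
    calc |z s j| * Real.exp (-(2 * C * s)) ≤ |z s j| * 1 := by
          gcongr; rw [Real.exp_le_one_iff]; have := hs.1; simp; positivity
      _ ≤ B := by simpa using hB s hs j
  have hmem : ∀ s ∈ Icc 0 T, ∀ j, |z s j| * Real.exp (-(2 * C * s)) ≤ sSup S := fun s hs j =>
    le_csSup hbdd ⟨(⟨s, hs⟩, j), rfl⟩
  have hK0 : 0 ≤ sSup S := le_trans (by positivity) (hmem t ht i)
  have key : ∀ s ∈ Icc 0 T, ∀ j, |z s j| ≤ sSup S * Real.exp (2 * C * s) := fun s hs j => by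
    have := mul_le_mul_of_nonneg_right (hmem s hs j) (Real.exp_pos (2 * C * s)).le
    rwa [mul_assoc, ← Real.exp_add, neg_add_cancel, Real.exp_zero, mul_one] at this
  have hle : sSup S ≤ ε + sSup S / 2 := by
    refine csSup_le ⟨_, ⟨(⟨t, ht⟩, i), rfl⟩⟩ ?_
    rintro _ ⟨⟨⟨s, hs⟩, j⟩, rfl⟩
    have h1 := h _ hK0 key s hs j
    have h2 : ∫ u in (0 : ℝ)..s, C * sSup S * Real.exp (2 * C * u) =
        sSup S / 2 * (Real.exp (2 * C * s) - 1) := by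
      rw [intervalIntegral.integral_const_mul, intervalIntegral.integral_comp_mul_left _ (by positivity)]
      simp only [mul_zero, integral_exp, Real.exp_zero, smul_eq_mul]
      field_simp
    rw [h2] at h1
    have h3 : 1 ≤ Real.exp (2 * C * s) := Real.one_le_exp (by have := hs.1; positivity)
    calc |z s j| * Real.exp (-(2 * C * s))
        ≤ (ε * Real.exp (2 * C * s) + sSup S / 2 * Real.exp (2 * C * s)) *
            Real.exp (-(2 * C * s)) := by
          gcongr; nlinarith
      _ = ε + sSup S / 2 := by
          rw [← add_mul, mul_assoc, ← Real.exp_add, add_neg_cancel, Real.exp_zero, mul_one]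
  calc |z t i| ≤ sSup S * Real.exp (2 * C * t) := key t ht i
    _ ≤ 2 * ε * Real.exp (2 * C * T) := by
      gcongr
      · linarith
      · exact ht.2

/-- Pointwise convergence of uniformly Lipschitz functions is uniform on compact sets. -/
theorem eventually_forall_abs_lt_of_isCompact {X : Type*} [PseudoMetricSpace X]
    {l : ℕ → X → ℝ} {C : ℝ}
    (hl : ∀ k x y, |l k x - l k y| ≤ C * dist x y) (h : ∀ x, Tendsto (fun k => l k x) atTop (𝓝 0))
    {S : Set X} (hS : IsCompact S) {ε : ℝ} (hε : 0 < ε) :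
    ∀ᶠ k in atTop, ∀ x ∈ S, |l k x| < ε := by
  -- The Lipschitz bound costs at most $\varepsilon/2$ on a ball of this radius; $|C|+1$ is positive
  -- whatever the sign of $C$.
  obtain ⟨F, -, hF, hcov⟩ := hS.finite_cover_balls (e := ε / (2 * (|C| + 1))) (by positivity)
  have h1 : ∀ᶠ k in atTop, ∀ y ∈ F, |l k y| < ε / 2 := by
    rw [Filter.eventually_all_finite hF]
    intro y _
    have := (h y).abs
    rw [abs_zero] at this
    exact this.eventually_lt_const (half_pos hε)
  filter_upwards [h1] with k hk x hx
  obtain ⟨y, hy, hxy⟩ := mem_iUnion₂.1 (hcov hx)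
  have h2 := hl k x y
  have h3 : C * dist x y ≤ ε / 2 := by
    calc C * dist x y ≤ (|C| + 1) * (ε / (2 * (|C| + 1))) := by
          gcongr
          · linarith [le_abs_self C]
          · exact (Metric.mem_ball.1 hxy).le
      _ = ε / 2 := by field_simp
  have h4 := abs_add_le (l k x - l k y) (l k y)
  rw [sub_add_cancel] at h4
  linarith [hk y hy]

/-- An equi-Lipschitz sequence changes little between nearby points. This extends limits known on
countable families (the dense sequences) to all test functions. -/
theorem tendsto_zero_of_mem_closure {X : Type*} [PseudoMetricSpace X] {l : ℕ → X → ℝ} {C : ℝ}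
    (hl : ∀ k x y, |l k x - l k y| ≤ C * dist x y) {D : Set X}
    (h : ∀ x ∈ D, Tendsto (fun k => l k x) atTop (𝓝 0)) {x : X} (hx : x ∈ closure D) :
    Tendsto (fun k => l k x) atTop (𝓝 0) := by
  refine Metric.tendsto_atTop.2 fun ε hε => ?_
  obtain ⟨y, hyD, hy⟩ := Metric.mem_closure_iff.1 hx (ε / (2 * (|C| + 1))) (by positivity)
  obtain ⟨K, hK⟩ := Metric.tendsto_atTop.1 (h y hyD) (ε / 2) (by positivity)
  refine ⟨K, fun k hk => ?_⟩
  have h1 := hK k hk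
  rw [Real.dist_eq, sub_zero] at h1 ⊢
  have h2 : C * dist x y ≤ ε / 2 := by
    calc C * dist x y ≤ (|C| + 1) * (ε / (2 * (|C| + 1))) := by
          gcongr
          linarith [le_abs_self C]
      _ = ε / 2 := by field_simp
  have h3 := abs_sub_abs_le_abs_sub (l k x) (l k y)
  linarith [hl k x y]

/-! ### Functions on the torus -/

/-- The projection of $\mathbb R^d$ onto the torus is an open quotient map, so continuity can be
tested on the lift. -/
theorem IsC1.continuous {d : ℕ} {f : Torus d → ℝ} (hf : IsC1 f) : Continuous f := by
  have h : IsOpenQuotientMap (Pi.map fun (_ : Fin d) (x : ℝ) => (x : UnitAddCircle)) :=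
    IsOpenQuotientMap.piMap fun _ => QuotientAddGroup.isOpenQuotientMap_mk
  exact (h.continuous_comp_iff).1 (ContDiff.continuous hf)

theorem integrable_of_continuous {d : ℕ} {f : Torus d → ℝ} (hf : Continuous f) :
    Integrable f := by
  simpa using hf.continuousOn.integrableOn_compact (μ := volume) isCompact_univ

theorem abs_integral_mul_le {d : ℕ} {f G : Torus d → ℝ} {B D : ℝ}
    (hf : ∀ᵐ r, |f r| ≤ B) (hG : ∀ r, |G r| ≤ D) : |∫ r, f r * G r| ≤ B * D := by
  have h := norm_integral_le_of_norm_le_const (μ := (volume : Measure (Torus d)))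
    (f := fun r => f r * G r) (C := B * D) (by
      filter_upwards [hf] with r hr
      rw [Real.norm_eq_abs, abs_mul]
      exact mul_le_mul hr (hG r) (abs_nonneg _) ((abs_nonneg _).trans hr))
  simpa using h

/-! ### The duality bracket -/

theorem integrable_density {d : ℕ} {f : Torus d → ℝ} (hf : Integrable f) (G : C(Torus d, ℝ)) :
    (density f).Integrable G := by
  unfold density VectorMeasure.Integrable
  rw [Measure.variation_withDensityᵥ hf]
  have : IsFiniteMeasure ((volume : Measure (Torus d)).withDensity fun x => ‖f x‖ₑ) :=
    isFiniteMeasure_withDensity hf.2.ne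
  simpa using G.continuous.continuousOn.integrableOn_compact (μ := (volume : Measure (Torus d)).withDensity fun x => ‖f x‖ₑ) isCompact_univ

theorem pairing_density {d : ℕ} {f : Torus d → ℝ} (hf : Integrable f) (G : C(Torus d, ℝ)) :
    pairing (density f) G = ∫ r, f r * G r := by
  have := isFiniteMeasure_withDensity_ofReal hf.2
  have := isFiniteMeasure_withDensity_ofReal hf.neg.2
  have hi : ∀ ν : Measure (Torus d), [IsFiniteMeasure ν] → ν.toSignedMeasure.Integrable G := by
    intro ν _
    unfold VectorMeasure.Integrable
    rw [Measure.variation_toSignedMeasure]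
    simpa using G.continuous.continuousOn.integrableOn_compact (μ := ν) isCompact_univ
  have hneg : AEMeasurable (fun r => ENNReal.ofReal (-f r)) :=
    hf.neg.aemeasurable.ennreal_ofReal
  unfold pairing density
  rw [withDensityᵥ_eq_withDensity_pos_part_sub_withDensity_neg_part hf,
    VectorMeasure.integral_sub_vectorMeasure (hi _) (hi _),
    VectorMeasure.integral_toSignedMeasure, VectorMeasure.integral_toSignedMeasure,
    integral_withDensity_eq_integral_toReal_smul₀ hf.aemeasurable.ennreal_ofReal (by simp),
    integral_withDensity_eq_integral_toReal_smul₀ hneg (by simp),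
    ← integral_sub]
  · refine integral_congr_ae (Eventually.of_forall fun r => ?_)
    simp only [smul_eq_mul, ← sub_mul, ENNReal.toReal_ofReal']
    rw [max_zero_sub_max_neg_zero_eq_self]
  · refine Integrable.mul_bdd (c := ‖G‖) ?_ G.continuous.aestronglyMeasurable
      (Eventually.of_forall G.norm_coe_le_norm)
    simpa [ENNReal.toReal_ofReal'] using hf.pos_part
  · refine Integrable.mul_bdd (c := ‖G‖) ?_ G.continuous.aestronglyMeasurable
      (Eventually.of_forall G.norm_coe_le_norm)
    simpa [ENNReal.toReal_ofReal'] using hf.neg_part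

theorem integrable_empirical {d n : ℕ} [NeZero n] (σ : Config d n) (G : C(Torus d, ℝ)) :
    (empirical σ).Integrable G := by
  refine VectorMeasure.Integrable.smul_vectorMeasure
    (VectorMeasure.Integrable.finsetSum_vectorMeasure fun x _ =>
      VectorMeasure.Integrable.smul_vectorMeasure ?_ _) _
  unfold VectorMeasure.Integrable
  rw [Measure.variation_toSignedMeasure]
  simpa using G.continuous.continuousOn.integrableOn_compact (μ := Measure.dirac (pos x)) isCompact_univ

/-- The average `γ^d ∑_x σ(x) G(γx)`. -/
def avg {d n : ℕ} [NeZero n] (σ : Config d n) (G : Torus d → ℝ) : ℝ :=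
  (1 / (n : ℝ)) ^ d * ∑ x, spin σ x * G (pos x)

theorem pairing_empirical {d n : ℕ} [NeZero n] (σ : Config d n) (G : C(Torus d, ℝ)) :
    pairing (empirical σ) G = avg σ G := by
  have hi : ∀ x : Lattice d n, ((Measure.dirac (pos x)).toSignedMeasure).Integrable G := fun x => by
    unfold VectorMeasure.Integrable
    rw [Measure.variation_toSignedMeasure]
    simpa using G.continuous.continuousOn.integrableOn_compact (μ := Measure.dirac (pos x)) isCompact_univ
  unfold pairing empirical avg
  rw [VectorMeasure.integral_smul_vectorMeasure, VectorMeasure.integral_finsetSum_vectorMeasure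
    fun x _ => (hi x).smul_vectorMeasure _]
  simp [VectorMeasure.integral_smul_vectorMeasure]

theorem pairing_sub {d n : ℕ} [NeZero n] (σ : Config d n) {f : Torus d → ℝ} (hf : Integrable f)
    (G : C(Torus d, ℝ)) :
    pairing (empirical σ - density f) G = avg σ G - ∫ r, f r * G r := by
  rw [← pairing_empirical, ← pairing_density hf]
  exact VectorMeasure.integral_sub_vectorMeasure (integrable_empirical σ G)
    (integrable_density hf G)

section

variable {d n : ℕ}

/-! ### Measurability of functionals of a path -/

theorem measurable_canonicalFiltration_at (g : Config d n → ℝ) {s t : ℝ≥0} (hst : s ≤ t) :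
    Measurable[canonicalFiltration d n t] fun w : Path d n => g (w.at s) := by
  have h : MeasurableSpace.comap (fun w : Path d n => w.at s) ⊤ ≤ canonicalFiltration d n t :=
    le_iSup₂_of_le (f := fun (s : ℝ≥0) (_ : s ≤ t) =>
      MeasurableSpace.comap (fun w : Path d n => w.at s) ⊤) s hst le_rfl
  have h' : Measurable[MeasurableSpace.comap (fun w : Path d n => w.at s) ⊤]
      fun w : Path d n => g (w.at s) := fun u _ => ⟨g ⁻¹' u, trivial, rfl⟩
  exact h'.mono h le_rfl

theorem measurable_at (g : Config d n → ℝ) (t : ℝ≥0) :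
    Measurable fun w : Path d n => g (w.at t) :=
  (measurable_canonicalFiltration_at g le_rfl).mono ((canonicalFiltration d n).le t) le_rfl

variable [NeZero n]

theorem tendsto_at (g : Config d n → ℝ) (w : Path d n) (t : ℝ≥0) :
    Tendsto (fun s => g (w.at s)) (𝓝[≥] t) (𝓝 (g (w.at t))) :=
  ((continuous_of_discreteTopology (f := g)).tendsto _).comp (w.2.1 t)

/-- Right continuity makes the path the limit of its values at discretized times approaching from
the right, and these are jointly measurable. Fubini needs this below. -/
theorem measurable_uncurry_at (g : Config d n → ℝ) :
    Measurable fun q : ℝ × Path d n => g (q.2.at q.1.toNNReal) := by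
  -- The `+ 1` after the floor keeps the discretized time to the right of `s`, where the path is
  -- continuous.
  let u : ℕ → ℝ≥0 → ℝ≥0 := fun k s => (⌊(k + 1 : ℝ≥0) * s⌋₊ + 1) / (k + 1)
  have hu : ∀ s, Tendsto (fun k => u k s) atTop (𝓝[≥] s) := by
    intro s
    refine tendsto_nhdsWithin_iff.2 ⟨?_, Eventually.of_forall fun k => ?_⟩
    · have h1 : Tendsto (fun k : ℕ => s + 1 / ((k : ℝ≥0) + 1)) atTop (𝓝 (s + 0)) :=
        tendsto_const_nhds.add (tendsto_one_div_add_atTop_nhds_zero_nat (𝕜 := ℝ≥0))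
      rw [add_zero] at h1
      refine tendsto_of_tendsto_of_tendsto_of_le_of_le tendsto_const_nhds h1 (fun k => ?_)
        fun k => ?_
      · show s ≤ (⌊(k + 1 : ℝ≥0) * s⌋₊ + 1) / (k + 1)
        rw [le_div_iff₀ (by positivity), mul_comm]
        exact (Nat.lt_floor_add_one _).le
      · show (⌊(k + 1 : ℝ≥0) * s⌋₊ + 1) / (k + 1) ≤ s + 1 / ((k : ℝ≥0) + 1)
        have e : (s + 1 / ((k : ℝ≥0) + 1)) * (k + 1) = (k + 1) * s + 1 := by field_simp
        rw [div_le_iff₀ (by positivity), e]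
        gcongr
        exact Nat.floor_le (by positivity)
    · show s ≤ (⌊(k + 1 : ℝ≥0) * s⌋₊ + 1) / (k + 1)
      rw [le_div_iff₀ (by positivity), mul_comm]
      exact (Nat.lt_floor_add_one _).le
  refine measurable_of_tendsto_metrizable
    (f := fun k (q : ℝ × Path d n) => g (q.2.at (u k q.1.toNNReal))) (fun k => ?_)
    (tendsto_pi_nhds.2 fun q => (tendsto_at g q.2 _).comp (hu _))
  have h : Measurable fun q : ℕ × Path d n => g (q.2.at ((q.1 + 1) / (k + 1))) :=
    measurable_from_prod_countable_right fun m => measurable_at g ((m + 1) / (k + 1))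
  exact h.comp ((Nat.measurable_floor.comp
    (measurable_const.mul (measurable_real_toNNReal.comp measurable_fst))).prodMk measurable_snd)

theorem exists_forall_abs_le (g : Config d n → ℝ) : ∃ B, 0 ≤ B ∧ ∀ σ, |g σ| ≤ B := by
  refine ⟨∑ σ, |g σ|, by positivity, fun σ => ?_⟩
  exact Finset.single_le_sum (f := fun σ => |g σ|) (fun _ _ => abs_nonneg _) (Finset.mem_univ σ)

theorem measurable_at_time (g : Config d n → ℝ) (w : Path d n) :
    Measurable fun s : ℝ => g (w.at s.toNNReal) :=
  (measurable_uncurry_at g).comp (measurable_id.prodMk measurable_const)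

theorem intervalIntegrable_of_bounded {f : ℝ → ℝ} (hf : Measurable f) {B a b : ℝ}
    (hB : ∀ s ∈ uIcc a b, |f s| ≤ B) : IntervalIntegrable f volume a b := by
  refine (intervalIntegrable_const (c := B) (μ := volume)).mono_fun hf.aestronglyMeasurable ?_
  refine (ae_restrict_iff' measurableSet_uIoc).2 (Eventually.of_forall fun s hs => ?_)
  exact (hB s (uIoc_subset_uIcc hs)).trans (le_abs_self B)

theorem intervalIntegrable_at (g : Config d n → ℝ) (w : Path d n) (a b : ℝ) :
    IntervalIntegrable (fun s : ℝ => g (w.at s.toNNReal)) volume a b := by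
  obtain ⟨B, -, hB⟩ := exists_forall_abs_le g
  exact intervalIntegrable_of_bounded (measurable_at_time g w) fun s _ => hB _

theorem measurable_integral_at (g : Config d n → ℝ) (a b : ℝ) :
    Measurable fun w : Path d n => ∫ s in a..b, g (w.at s.toNNReal) := by
  simp only [intervalIntegral]
  have h : StronglyMeasurable (Function.uncurry fun (w : Path d n) (s : ℝ) =>
      g (w.at s.toNNReal)) :=
    ((measurable_uncurry_at g).comp measurable_swap).stronglyMeasurable
  exact (h.integral_prod_right.sub h.integral_prod_right).measurable

theorem continuous_integral_at (g : Config d n → ℝ) (w : Path d n) :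
    Continuous fun t : ℝ => ∫ s in (0 : ℝ)..t, g (w.at s.toNNReal) :=
  intervalIntegral.continuous_primitive (fun a b => intervalIntegrable_at g w a b) 0

theorem abs_integral_at_le {g : Config d n → ℝ} {B : ℝ} (hB : ∀ σ, |g σ| ≤ B) (w : Path d n)
    (t : ℝ≥0) : |∫ s in (0 : ℝ)..t, g (w.at s.toNNReal)| ≤ B * t := by
  have := intervalIntegral.norm_integral_le_of_norm_le_const (a := 0) (b := (t : ℝ))
    (f := fun s : ℝ => g (w.at s.toNNReal)) (C := B) fun s _ => hB _
  simpa using this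

/-! ### The martingales of the dynamics -/

/-- The martingale `f(σ_t) - f(σ_0) - ∫₀ᵗ L f(σ_s) ds`. -/
def mart (J : Torus d → ℝ) (θ : ℝ) (α : (Fin d → ℤ) → ℝ) (f : Config d n → ℝ) (t : ℝ≥0)
    (w : Path d n) : ℝ :=
  f (w.at t) - f (w.at 0) - ∫ s in (0 : ℝ)..t, generator J θ α f (w.at s.toNNReal)

variable {J : Torus d → ℝ} {θ : ℝ} {α : (Fin d → ℤ) → ℝ} {η : Config d n}
  {P : Measure (Path d n)}

theorem measurable_mart (f : Config d n → ℝ) (t : ℝ≥0) : Measurable (mart J θ α f t) :=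
  ((measurable_at f t).sub (measurable_at f 0)).sub (measurable_integral_at _ _ _)

theorem mart_zero (f : Config d n → ℝ) (w : Path d n) : mart J θ α f 0 w = 0 := by
  simp [mart]

theorem measurable_uncurry_mart (f : Config d n → ℝ) :
    Measurable fun q : ℝ × Path d n => mart J θ α f q.1.toNNReal q.2 := by
  refine ((measurable_uncurry_at f).sub ((measurable_at f 0).comp measurable_snd)).sub ?_
  have h : Measurable (Function.uncurry fun (t : ℝ) (w : Path d n) =>
      ∫ s in (0 : ℝ)..t, generator J θ α f (w.at s.toNNReal)) :=
    measurable_uncurry_of_continuous_of_measurable (fun w => continuous_integral_at _ w)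
      fun t => measurable_integral_at _ _ _
  exact h.comp (((measurable_real_toNNReal.comp measurable_fst).coe_nnreal_real).prodMk
    measurable_snd)

theorem exists_abs_mart_le (f : Config d n → ℝ) (T : ℝ≥0) :
    ∃ B, 0 ≤ B ∧ ∀ t ≤ T, ∀ w, |mart J θ α f t w| ≤ B := by
  obtain ⟨B, hB0, hB⟩ := exists_forall_abs_le f
  obtain ⟨D, hD0, hD⟩ := exists_forall_abs_le (generator J θ α f)
  refine ⟨2 * B + D * T, by positivity, fun t ht w => ?_⟩
  have h1 := abs_integral_at_le hD w t
  have h2 : D * (t : ℝ) ≤ D * T := by gcongr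
  unfold mart
  rw [abs_le] at *
  have h3 := abs_le.1 (hB (w.at t))
  have h4 := abs_le.1 (hB (w.at 0))
  constructor <;> linarith

theorem tendsto_mart (f : Config d n → ℝ) (w : Path d n) (t : ℝ≥0) :
    Tendsto (fun s => mart J θ α f s w) (𝓝[≥] t) (𝓝 (mart J θ α f t w)) := by
  refine ((tendsto_at f w t).sub tendsto_const_nhds).sub ?_
  exact (((continuous_integral_at (generator J θ α f) w).comp NNReal.continuous_coe).tendsto
    t).mono_left nhdsWithin_le_nhds

theorem IsGlauberLaw.integrable_mart (hP : IsGlauberLaw J θ α η P) (f : Config d n → ℝ)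
    (t : ℝ≥0) : Integrable (mart J θ α f t) P :=
  (hP.martingale f).integrable t

theorem IsGlauberLaw.integral_mart (hP : IsGlauberLaw J θ α η P) (f : Config d n → ℝ)
    (t : ℝ≥0) : ∫ w, mart J θ α f t w ∂P = 0 := by
  have := hP.isProbabilityMeasure
  have h : ∫ w, mart J θ α f 0 w ∂P = ∫ w, mart J θ α f t w ∂P := by
    have := (hP.martingale f).setIntegral_eq (zero_le (a := t)) MeasurableSet.univ
    rw [setIntegral_univ, setIntegral_univ] at this
    exact this
  rw [← h]
  simp [mart_zero]

/-- Martingale increments are orthogonal to bounded functions of the past; here conditioning at time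
`s` pulls out the factor `g (w.at s)`. -/
theorem IsGlauberLaw.integral_mart_sub_mul (hP : IsGlauberLaw J θ α η P)
    (f g : Config d n → ℝ) {s t : ℝ≥0} (hst : s ≤ t) :
    ∫ w, (mart J θ α f t w - mart J θ α f s w) * g (w.at s) ∂P = 0 := by
  have := hP.isProbabilityMeasure
  obtain ⟨B, hB0, hB⟩ := exists_forall_abs_le g
  have hint : ∀ u, Integrable (fun w => mart J θ α f u w * g (w.at s)) P := fun u =>
    (hP.integrable_mart f u).mul_bdd (c := B) (measurable_at g s).aestronglyMeasurable
      (Eventually.of_forall fun w => hB _)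
  simp only [sub_mul]
  rw [integral_sub (hint t) (hint s), sub_eq_zero]
  have h1 : P[mart J θ α f t * fun w => g (w.at s) | canonicalFiltration d n s] =ᵐ[P]
      mart J θ α f s * fun w => g (w.at s) := by
    refine (condExp_mul_of_stronglyMeasurable_right
      (measurable_canonicalFiltration_at g le_rfl).stronglyMeasurable (hint t)
      (hP.integrable_mart f t)).trans ?_
    filter_upwards [(hP.martingale f).2 s t hst] with w hw
    simp only [Pi.mul_apply]
    exact congrArg (· * g (w.at s)) hw
  have h2 := integral_condExp (μ := P) ((canonicalFiltration d n).le s)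
    (f := mart J θ α f t * fun w => g (w.at s))
  rw [integral_congr_ae h1] at h2
  exact h2.symm

/-- This is $\int A\,A'=A^2/2$. The integrand is only right continuous, so the fundamental theorem
is used in its right-derivative form. -/
theorem integral_primitive_mul (g : Config d n → ℝ) (w : Path d n) (t : ℝ≥0) :
    ∫ s in (0 : ℝ)..t, (∫ u in (0 : ℝ)..s, g (w.at u.toNNReal)) * g (w.at s.toNNReal) =
      (∫ s in (0 : ℝ)..t, g (w.at s.toNNReal)) ^ 2 / 2 := by
  set A : ℝ → ℝ := fun s => ∫ u in (0 : ℝ)..s, g (w.at u.toNNReal) with hA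
  obtain ⟨B, hB0, hB⟩ := exists_forall_abs_le g
  have hc : Continuous A := continuous_integral_at g w
  have hd : ∀ s ∈ Ioo (0 : ℝ) t, HasDerivWithinAt (fun s => A s ^ 2 / 2)
      (A s * g (w.at s.toNNReal)) (Ioi s) s := by
    intro s hs
    have h1 : HasDerivWithinAt A (g (w.at s.toNNReal)) (Ioi s) s := by
      refine HasDerivWithinAt.mono ?_ Ioi_subset_Ici_self
      refine intervalIntegral.integral_hasDerivWithinAt_right (s := Ici s) (t := Ioi s)
        (intervalIntegrable_at g w _ _)
        ((measurable_at_time g w).stronglyMeasurable.stronglyMeasurableAtFilter) ?_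
      have h2 : Tendsto Real.toNNReal (𝓝[>] s) (𝓝[≥] s.toNNReal) :=
        tendsto_nhdsWithin_iff.2 ⟨(continuous_real_toNNReal.tendsto s).mono_left
          nhdsWithin_le_nhds, eventually_nhdsWithin_of_forall fun u hu =>
          Real.toNNReal_le_toNNReal (le_of_lt hu)⟩
      exact (tendsto_at g w _).comp h2
    have h3 := (h1.pow 2).div_const 2
    have e : ((2 : ℕ) : ℝ) * A s ^ (2 - 1) * g (w.at s.toNNReal) / 2 = A s * g (w.at s.toNNReal) := by
      norm_num
      ring
    rw [e] at h3
    exact h3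
  change ∫ s in (0 : ℝ)..t, A s * g (w.at s.toNNReal) = A t ^ 2 / 2
  rw [intervalIntegral.integral_eq_sub_of_hasDeriv_right_of_le t.coe_nonneg
    (f := fun s => A s ^ 2 / 2) ((hc.pow 2).div_const 2).continuousOn hd]
  · simp [hA]
  · have h := hc.intervalIntegrable (μ := volume) 0 (t : ℝ)
    rw [intervalIntegrable_iff] at h ⊢
    exact Integrable.mul_bdd (c := B) h (measurable_at_time g w).aestronglyMeasurable
      (Eventually.of_forall fun s => hB _)

/-- The carré du champ of the generator. -/
theorem generator_sq_sub (f : Config d n → ℝ) (c : ℝ) (σ : Config d n) :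
    generator J θ α (fun τ => (f τ - c) ^ 2) σ - 2 * (f σ - c) * generator J θ α f σ =
      ∑ x, rate J θ α x σ * (f (flip σ x) - f σ) ^ 2 := by
  unfold generator
  rw [Finset.mul_sum, ← Finset.sum_sub_distrib]
  exact Finset.sum_congr rfl fun x _ => by ring

/-- A pathwise substitute for the bracket of the martingale. With $F=f(\sigma_t)-f(\sigma_0)$ and
$A=\int_0^t Lf$, both sides equal $(F-A)^2$. The point is that the first term on the right has mean
zero and the last is an integral of increments against the past. -/
theorem sq_mart_eq (f : Config d n → ℝ) (t : ℝ≥0) (w : Path d n) :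
    mart J θ α f t w ^ 2 = mart J θ α (fun τ => (f τ - f (w.at 0)) ^ 2) t w +
      (∫ s in (0 : ℝ)..t, ∑ x, rate J θ α x (w.at s.toNNReal) *
        (f (flip (w.at s.toNNReal) x) - f (w.at s.toNNReal)) ^ 2) -
      2 * ∫ s in (0 : ℝ)..t, (mart J θ α f t w - mart J θ α f s.toNNReal w) *
        generator J θ α f (w.at s.toNNReal) := by
  set c := f (w.at 0) with hc
  set g := generator J θ α f with hg
  set q : Config d n → ℝ := fun τ => (f τ - c) ^ 2 with hq
  set A := ∫ s in (0 : ℝ)..t, g (w.at s.toNNReal) with hA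
  set I := ∫ s in (0 : ℝ)..t, (f (w.at s.toNNReal) - c) * g (w.at s.toNNReal) with hI
  have e1 : (∫ s in (0 : ℝ)..t, ∑ x, rate J θ α x (w.at s.toNNReal) *
        (f (flip (w.at s.toNNReal) x) - f (w.at s.toNNReal)) ^ 2) =
      (∫ s in (0 : ℝ)..t, generator J θ α q (w.at s.toNNReal)) - 2 * I := by
    rw [hI, ← intervalIntegral.integral_const_mul, ← intervalIntegral.integral_sub
      (intervalIntegrable_at _ w _ _)
      (intervalIntegrable_at (fun σ => 2 * ((f σ - c) * g σ)) w _ _)]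
    refine intervalIntegral.integral_congr fun s _ => ?_
    rw [← generator_sq_sub f c]
    ring
  have e2 : (∫ s in (0 : ℝ)..t, (mart J θ α f t w - mart J θ α f s.toNNReal w) *
      g (w.at s.toNNReal)) = mart J θ α f t w * A - I + A ^ 2 / 2 := by
    rw [← integral_primitive_mul g w t, hI, hA, ← intervalIntegral.integral_const_mul,
      ← intervalIntegral.integral_sub, ← intervalIntegral.integral_add]
    · refine intervalIntegral.integral_congr fun s hs => ?_
      rw [uIcc_of_le t.coe_nonneg] at hs
      simp only [mart, Real.coe_toNNReal s hs.1]
      ring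
    · exact (intervalIntegrable_at (fun σ => mart J θ α f t w * g σ) w _ _).sub
        (intervalIntegrable_at (fun σ => (f σ - c) * g σ) w _ _)
    · obtain ⟨B, hB0, hB⟩ := exists_forall_abs_le g
      have h := (continuous_integral_at g w).intervalIntegrable (μ := volume) 0 (t : ℝ)
      rw [intervalIntegrable_iff] at h ⊢
      exact Integrable.mul_bdd (c := B) h (measurable_at_time g w).aestronglyMeasurable
        (Eventually.of_forall fun s => hB _)
    · exact intervalIntegrable_at (fun σ => mart J θ α f t w * g σ) w _ _
    · exact intervalIntegrable_at (fun σ => (f σ - c) * g σ) w _ _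
  rw [e1, e2]
  have e3 : mart J θ α f t w = f (w.at t) - c - A := rfl
  have e4 : mart J θ α q t w = (f (w.at t) - c) ^ 2 - (f (w.at 0) - c) ^ 2 -
      ∫ s in (0 : ℝ)..t, generator J θ α q (w.at s.toNNReal) := rfl
  rw [e4, e3, ← hc]
  ring

/-- On taking expectations in `sq_mart_eq`, the first term vanishes by the martingale property and
the last by Fubini and `integral_mart_sub_mul`; only the carré du champ remains. -/
theorem IsGlauberLaw.integral_sq_mart_le (hP : IsGlauberLaw J θ α η P) {f : Config d n → ℝ}
    {C : ℝ} (hC : ∀ σ, ∑ x, rate J θ α x σ * (f (flip σ x) - f σ) ^ 2 ≤ C) (t : ℝ≥0) :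
    ∫ w, mart J θ α f t w ^ 2 ∂P ≤ C * t := by
  have := hP.isProbabilityMeasure
  set g := generator J θ α f with hg
  obtain ⟨B, hB0, hB⟩ := exists_abs_mart_le (J := J) (θ := θ) (α := α) f t
  obtain ⟨D, hD0, hD⟩ := exists_forall_abs_le g
  set Γ : Config d n → ℝ := fun σ => ∑ x, rate J θ α x σ * (f (flip σ x) - f σ) ^ 2 with hΓ
  replace hC : ∀ σ, Γ σ ≤ C := hC
  -- The centring `f (w.at 0)` depends on the path. Replacing it by the almost surely equal constant
  -- `f η` gives a fixed function, to which the martingale problem applies.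
  have hae : (fun w => mart J θ α f t w ^ 2) =ᵐ[P] fun w =>
      mart J θ α (fun τ => (f τ - f η) ^ 2) t w + (∫ s in (0 : ℝ)..t, Γ (w.at s.toNNReal)) -
      2 * ∫ s in (0 : ℝ)..t, (mart J θ α f t w - mart J θ α f s.toNNReal w) *
        g (w.at s.toNNReal) := by
    filter_upwards [hP.initial] with w hw
    rw [sq_mart_eq, hw]
  clear_value Γ g
  obtain ⟨E, hE0, hE⟩ := exists_forall_abs_le Γ
  obtain ⟨K, hK⟩ : ∃ K : ℝ → Path d n → ℝ, K = fun s w =>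
    (mart J θ α f t w - mart J θ α f s.toNNReal w) * g (w.at s.toNNReal) := ⟨_, rfl⟩
  have hKs : ∀ s w, (mart J θ α f t w - mart J θ α f s.toNNReal w) * g (w.at s.toNNReal) =
    K s w := fun s w => by rw [hK]
  have hmeas : Measurable (Function.uncurry K) := by
    rw [hK]
    exact (((measurable_mart f t).comp measurable_snd).sub (measurable_uncurry_mart f)).mul
      (measurable_uncurry_at g)
  have hKbound : ∀ s ≤ (t : ℝ), ∀ w, ‖K s w‖ ≤ 2 * B * D := fun s hs w => by
    rw [← hKs, Real.norm_eq_abs, abs_mul]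
    have h2 := hB t le_rfl w
    have h3 := hB s.toNNReal (Real.toNNReal_le_iff_le_coe.2 hs) w
    have h4 := abs_sub (mart J θ α f t w) (mart J θ α f s.toNNReal w)
    exact mul_le_mul (by linarith) (hD _) (abs_nonneg _) (by positivity)
  have hKzero : ∀ s ≤ (t : ℝ), ∫ w, K s w ∂P = 0 := fun s hs => by
    simp only [← hKs]
    exact hP.integral_mart_sub_mul f g (Real.toNNReal_le_iff_le_coe.2 hs)
  simp only [hKs] at hae
  clear hK hKs
  have hint : Integrable (Function.uncurry K) ((volume.restrict (Ioc 0 (t : ℝ))).prod P) := by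
    refine Integrable.of_bound hmeas.aestronglyMeasurable (2 * B * D) ?_
    have h1 : ∀ᵐ q ∂((volume.restrict (Ioc 0 (t : ℝ))).prod P), q.1 ∈ Ioc 0 (t : ℝ) :=
      Measure.quasiMeasurePreserving_fst.ae (ae_restrict_mem measurableSet_Ioc)
    filter_upwards [h1] with q hq using hKbound q.1 hq.2 q.2
  have hzero : ∫ w, (∫ s in (0 : ℝ)..t, K s w) ∂P = 0 := by
    simp only [intervalIntegral.integral_of_le t.coe_nonneg]
    rw [← integral_integral_swap hint]
    exact setIntegral_eq_zero_of_forall_eq_zero fun s hs => hKzero s hs.2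
  have hintD : Integrable (fun w => ∫ s in (0 : ℝ)..t, K s w) P := by
    simp only [intervalIntegral.integral_of_le t.coe_nonneg]
    exact hint.integral_prod_right
  have hintΓ : Integrable (fun w : Path d n => ∫ s in (0 : ℝ)..t, Γ (w.at s.toNNReal)) P :=
    Integrable.of_bound (measurable_integral_at Γ _ _).aestronglyMeasurable (E * t)
      (Eventually.of_forall fun w => by
        rw [Real.norm_eq_abs]
        exact abs_integral_at_le hE w t)
  have hΓle : ∫ w : Path d n, (∫ s in (0 : ℝ)..t, Γ (w.at s.toNNReal)) ∂P ≤ C * t := by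
    have h : ∀ w : Path d n, (∫ s in (0 : ℝ)..t, Γ (w.at s.toNNReal)) ≤ C * t := fun w => by
      calc (∫ s in (0 : ℝ)..t, Γ (w.at s.toNNReal)) ≤ ∫ s in (0 : ℝ)..t, C :=
            intervalIntegral.integral_mono_on t.coe_nonneg (intervalIntegrable_at Γ w _ _)
              intervalIntegrable_const fun s _ => hC _
        _ = C * t := by simp [mul_comm]
    calc _ ≤ ∫ w : Path d n, C * t ∂P :=
          integral_mono hintΓ (integrable_const _) h
      _ = C * t := by simp
  have hM := hP.integrable_mart (fun τ => (f τ - f η) ^ 2) t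
  have hMΓ : Integrable (fun w => mart J θ α (fun τ => (f τ - f η) ^ 2) t w +
      ∫ s in (0 : ℝ)..t, Γ (w.at s.toNNReal)) P := hM.add hintΓ
  rw [integral_congr_ae hae, integral_sub hMΓ (hintD.const_mul 2), integral_add hM hintΓ,
    integral_const_mul, hzero, hP.integral_mart]
  linarith

/-- Doob's maximal inequality for the martingales of the dynamics. -/
theorem IsGlauberLaw.measure_exists_lt_mart_le (hP : IsGlauberLaw J θ α η P)
    {f : Config d n → ℝ}
    {C : ℝ} (hC : ∀ σ, ∑ x, rate J θ α x σ * (f (flip σ x) - f σ) ^ 2 ≤ C) (T : ℝ≥0) {ε : ℝ}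
    (hε : 0 < ε) :
    P {w | ∃ t ≤ T, ε < |mart J θ α f t w|} ≤ ENNReal.ofReal (C * T / ε ^ 2) := by
  have := hP.isProbabilityMeasure
  -- Doob's inequality is discrete, so it is applied on dyadic grids of $[0,T]$, with a bound that
  -- does not depend on the grid.
  let u : ℕ → ℕ → ℝ≥0 := fun j k => T * (k / 2 ^ j)
  have hu : ∀ j, Monotone (u j) := fun j k l hkl => by
    simp only [u]
    gcongr
  have huT : ∀ j, u j (2 ^ j) = T := fun j => by simp [u]
  let G : ℕ → Set (Path d n) := fun j => {w | ∃ k ≤ 2 ^ j, ε < |mart J θ α f (u j k) w|}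
  have hsub : {w | ∃ t ≤ T, ε < |mart J θ α f t w|} ⊆ ⋃ j, G j := by
    rintro w ⟨t, htT, ht⟩
    have hT : T ≠ 0 := by
      rintro rfl
      rw [nonpos_iff_eq_zero.1 htT, mart_zero] at ht
      simp only [abs_zero] at ht
      linarith
    -- Rounding up approaches `t` from the right. By right continuity the strict inequality at `t`
    -- persists at a grid time.
    let k : ℕ → ℕ := fun j => ⌈t / T * 2 ^ j⌉₊
    have h2 : Tendsto (fun j : ℕ => t + T * (1 / 2 : ℝ≥0) ^ j) atTop (𝓝 t) := by
      have h3 : Tendsto (fun j : ℕ => (1 / 2 : ℝ≥0) ^ j) atTop (𝓝 0) :=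
        NNReal.tendsto_pow_atTop_nhds_zero_of_lt_one (NNReal.half_lt_self one_ne_zero)
      simpa using tendsto_const_nhds.add (h3.const_mul T)
    have hge : ∀ j, t ≤ u j (k j) := fun j => by
      have h3 : t / T * 2 ^ j ≤ k j := Nat.le_ceil _
      calc t = T * (t / T * 2 ^ j / 2 ^ j) := by field_simp
        _ ≤ u j (k j) := by simp only [u]; gcongr
    have hle : ∀ j, u j (k j) ≤ t + T * (1 / 2 : ℝ≥0) ^ j := fun j => by
      have h3 : (k j : ℝ≥0) ≤ t / T * 2 ^ j + 1 := (Nat.ceil_lt_add_one (by positivity)).le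
      calc u j (k j) ≤ T * ((t / T * 2 ^ j + 1) / 2 ^ j) := by simp only [u]; gcongr
        _ = t + T * (1 / 2 : ℝ≥0) ^ j := by rw [one_div, inv_pow]; field_simp
    have h1 : Tendsto (fun j => u j (k j)) atTop (𝓝[≥] t) :=
      tendsto_nhdsWithin_iff.2 ⟨tendsto_of_tendsto_of_tendsto_of_le_of_le tendsto_const_nhds h2
        hge hle, Eventually.of_forall hge⟩
    obtain ⟨j, hj⟩ := (((tendsto_mart (J := J) (θ := θ) (α := α) f w t).comp
      h1).abs.eventually_const_lt ht).exists
    refine mem_iUnion.2 ⟨j, k j, ?_, hj⟩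
    refine Nat.ceil_le.2 ?_
    push_cast
    calc t / T * 2 ^ j ≤ 1 * 2 ^ j := by
          gcongr
          exact div_le_one_of_le₀ htT (by positivity)
      _ = 2 ^ j := one_mul _
  -- The grids are nested, so the measure of the union is the supremum of the measures.
  have hmono : Monotone G := monotone_nat_of_le_succ fun j w => by
    rintro ⟨k, hk, hw⟩
    refine ⟨2 * k, by rw [pow_succ]; omega, ?_⟩
    have e : u (j + 1) (2 * k) = u j k := by
      simp only [u]
      push_cast
      rw [pow_succ]
      field_simp
    rwa [e]
  have hbound : ∀ j, P (G j) ≤ ENNReal.ofReal (C * T / ε ^ 2) := fun j => by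
    let ℱ : Filtration ℕ (inferInstance : MeasurableSpace (Path d n)) :=
      { seq := fun k => canonicalFiltration d n (u j k)
        mono' := fun k l hkl => (canonicalFiltration d n).mono (hu j hkl)
        le' := fun k => (canonicalFiltration d n).le _ }
    have hsqint : ∀ k, Integrable (fun w => mart J θ α f (u j k) w ^ 2) P := fun k => by
      obtain ⟨B, hB0, hB⟩ := exists_abs_mart_le (J := J) (θ := θ) (α := α) f (u j k)
      refine Integrable.of_bound ((measurable_mart f _).pow_const 2).aestronglyMeasurable (B ^ 2)
        (Eventually.of_forall fun w => ?_)
      rw [Real.norm_eq_abs, abs_pow]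
      gcongr
      exact hB _ le_rfl w
    -- Conditional Jensen for $x\mapsto x^2$.
    have hS : Submartingale (fun k w => mart J θ α f (u j k) w ^ 2) ℱ P := by
      refine ⟨fun k => ((hP.martingale f).1 (u j k)).pow 2, fun k l hkl => ?_, hsqint⟩
      have h1 := ConvexOn.map_condExp_le_univ (μ := P) (φ := fun x : ℝ => x ^ 2)
        (f := mart J θ α f (u j l)) ((canonicalFiltration d n).le (u j k))
        (Even.convexOn_pow even_two) (continuous_pow 2).lowerSemicontinuous
        (hP.integrable_mart f _) (hsqint l)
      filter_upwards [h1, (hP.martingale f).2 _ _ (hu j hkl)] with w hw hw'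
      have h2 : mart J θ α f (u j k) w ^ 2 =
        (P[mart J θ α f (u j l) | canonicalFiltration d n (u j k)]) w ^ 2 :=
        congrArg (· ^ 2) hw'.symm
      rw [h2]
      exact hw
    have h1 := maximal_ineq hS (fun k w => sq_nonneg _) (ε := (ε ^ 2).toNNReal) (2 ^ j)
    have h2 : G j ⊆ {w | ((ε ^ 2).toNNReal : ℝ) ≤ (Finset.range (2 ^ j + 1)).sup'
        Finset.nonempty_range_add_one fun k => mart J θ α f (u j k) w ^ 2} := by
      rintro w ⟨k, hk, hw⟩
      refine le_trans ?_ (Finset.le_sup' (fun k => mart J θ α f (u j k) w ^ 2)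
        (Finset.mem_range.2 (Nat.lt_succ_of_le hk)))
      rw [Real.coe_toNNReal _ (by positivity), ← sq_abs (mart J θ α f (u j k) w)]
      gcongr
    have h3 : ((ε ^ 2).toNNReal : ℝ≥0∞) * P (G j) ≤ ENNReal.ofReal (C * T) := by
      refine (mul_le_mul_right (measure_mono h2) _).trans (h1.trans (ENNReal.ofReal_le_ofReal ?_))
      refine (setIntegral_le_integral (hsqint _) (Eventually.of_forall fun w => sq_nonneg _)).trans
        ?_
      rw [huT]
      exact hP.integral_sq_mart_le hC T
    rw [ENNReal.ofReal_div_of_pos (by positivity), ENNReal.le_div_iff_mul_le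
      (Or.inl (by simpa using by positivity)) (Or.inl ENNReal.ofReal_ne_top), mul_comm]
    exact h3
  calc _ ≤ P (⋃ j, G j) := measure_mono hsub
    _ = ⨆ j, P (G j) := hmono.measure_iUnion
    _ ≤ _ := iSup_le hbound

end

section

variable {d n : ℕ} [NeZero n]

/-! ### Averages over the lattice -/

/-- The average `γ^d ∑_x u(x)`. -/
def mean (u : Lattice d n → ℝ) : ℝ := (1 / (n : ℝ)) ^ d * ∑ x, u x

theorem avg_eq_mean (σ : Config d n) (G : Torus d → ℝ) :
    avg σ G = mean fun x => spin σ x * G (pos x) := rfl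

theorem mean_sub (u v : Lattice d n → ℝ) : mean (fun x => u x - v x) = mean u - mean v := by
  simp [mean, Finset.sum_sub_distrib, mul_sub]

theorem mean_const_mul (c : ℝ) (u : Lattice d n → ℝ) : mean (fun x => c * u x) = c * mean u := by
  simp [mean, ← Finset.mul_sum]
  ring

theorem mean_sum {ι : Type*} (s : Finset ι) (u : ι → Lattice d n → ℝ) :
    mean (fun x => ∑ i ∈ s, u i x) = ∑ i ∈ s, mean (u i) := by
  simp only [mean]
  rw [Finset.sum_comm, Finset.mul_sum]

theorem card_lattice : Fintype.card (Lattice d n) = n ^ d := by simp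

theorem mean_const (c : ℝ) : mean (fun _ : Lattice d n => c) = c := by
  have : (n : ℝ) ≠ 0 := NeZero.ne _
  simp only [mean, Finset.sum_const, Finset.card_univ, card_lattice, nsmul_eq_mul]
  push_cast
  rw [← mul_assoc, ← mul_pow, one_div_mul_cancel this, one_pow, one_mul]

theorem mean_mono {u v : Lattice d n → ℝ} (h : ∀ x, u x ≤ v x) : mean u ≤ mean v := by
  unfold mean
  gcongr with x
  exact h x

theorem abs_mean_le {u : Lattice d n → ℝ} {B : ℝ} (h : ∀ x, |u x| ≤ B) : |mean u| ≤ B := by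
  rw [abs_le]
  constructor
  · rw [← mean_const (d := d) (n := n) (-B)]
    exact mean_mono fun x => (abs_le.1 (h x)).1
  · rw [← mean_const (d := d) (n := n) B]
    exact mean_mono fun x => (abs_le.1 (h x)).2

theorem spin_eq (σ : Config d n) (x : Lattice d n) : spin σ x = 1 ∨ spin σ x = -1 := by
  unfold spin
  rcases Int.units_eq_one_or (σ x) with h | h <;> simp [h]

theorem abs_spin (σ : Config d n) (x : Lattice d n) : |spin σ x| = 1 := by
  rcases spin_eq σ x with h | h <;> simp [h]

theorem spin_mul_self (σ : Config d n) (x : Lattice d n) : spin σ x * spin σ x = 1 := by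
  rcases spin_eq σ x with h | h <;> simp [h]

theorem spin_flip (σ : Config d n) (x y : Lattice d n) :
    spin (flip σ x) y = spin σ y - if y = x then 2 * spin σ x else 0 := by
  unfold spin flip
  by_cases h : y = x
  · subst h
    simp
    ring
  · simp [h]

theorem abs_avg_le (σ : Config d n) {G : Torus d → ℝ} {B : ℝ} (hG : ∀ r, |G r| ≤ B) :
    |avg σ G| ≤ B :=
  abs_mean_le fun x => by rw [abs_mul, abs_spin, one_mul]; exact hG _

theorem avg_sub (σ : Config d n) (G G' : Torus d → ℝ) :
    avg σ (fun r => G r - G' r) = avg σ G - avg σ G' := by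
  simp only [avg_eq_mean, mul_sub]
  exact mean_sub _ _

theorem avg_flip (σ : Config d n) (x : Lattice d n) (G : Torus d → ℝ) :
    avg (flip σ x) G - avg σ G = -(2 * (1 / (n : ℝ)) ^ d * spin σ x * G (pos x)) := by
  simp only [avg, spin_flip, sub_mul, Finset.sum_sub_distrib, ite_mul, zero_mul,
    Finset.sum_ite_eq', Finset.mem_univ, if_true]
  ring

theorem pos_sub (x y : Lattice d n) : pos (x - y) = pos x - pos y := by
  ext i; simp [pos]

theorem pos_add (x y : Lattice d n) : pos (x + y) = pos x + pos y := by
  ext i; simp [pos]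

/-! ### The generator applied to averages -/

/-- The local field felt by the spin at `x`. -/
def localField (J : Torus d → ℝ) (θ : ℝ) (α : (Fin d → ℤ) → ℝ) (σ : Config d n)
    (x : Lattice d n) : ℝ :=
  avg σ (fun r => J (pos x - r)) - (1 / (n : ℝ)) ^ d * J 0 * spin σ x + θ * α (rep x)

variable {J : Torus d → ℝ} {θ : ℝ} {α : (Fin d → ℤ) → ℝ}

/-- By symmetry of $J$ the row and the column of `x` contribute equally to the change. The diagonal
term is invariant under the flip, which is why `localField` subtracts the self-interaction. -/
theorem hamiltonian_flip_sub (hJ : ∀ r, J (-r) = J r) (σ : Config d n) (x : Lattice d n) :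
    hamiltonian J θ α (flip σ x) - hamiltonian J θ α σ =
      2 * (spin σ x * localField J θ α σ x) := by
  have hsymm : ∀ y z : Lattice d n, kac J y z = kac J z y := fun y z => by
    unfold kac
    rw [← hJ (pos (y - z)), pos_sub, pos_sub, neg_sub]
  have hS : ∑ y, ∑ z, kac J y z * spin (flip σ x) y * spin (flip σ x) z =
      ∑ y, ∑ z, kac J y z * spin σ y * spin σ z - 4 * spin σ x * ∑ z, kac J x z * spin σ z +
        4 * kac J x x * (spin σ x * spin σ x) := by
    have h1 : ∀ y z, kac J y z * spin (flip σ x) y * spin (flip σ x) z =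
        kac J y z * spin σ y * spin σ z
        - (if y = x then kac J y z * (2 * spin σ x) * spin σ z else 0)
        - (if z = x then kac J y z * spin σ y * (2 * spin σ x) else 0)
        + (if y = x then (if z = x then kac J y z * (2 * spin σ x) * (2 * spin σ x) else 0)
            else 0) := fun y z => by
      rw [spin_flip, spin_flip]
      split_ifs <;> ring
    simp only [h1, Finset.sum_add_distrib, Finset.sum_sub_distrib, Finset.sum_ite_eq',
      Finset.mem_univ, if_true, Finset.sum_ite_irrel, Finset.sum_const_zero]
    have h2 : ∑ y, kac J y x * spin σ y * (2 * spin σ x) =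
        2 * spin σ x * ∑ z, kac J x z * spin σ z := by
      rw [Finset.mul_sum]
      exact Finset.sum_congr rfl fun y _ => by rw [hsymm y x]; ring
    have h3 : ∑ z, kac J x z * (2 * spin σ x) * spin σ z =
        2 * spin σ x * ∑ z, kac J x z * spin σ z := by
      rw [Finset.mul_sum]
      exact Finset.sum_congr rfl fun y _ => by ring
    rw [h2, h3]
    ring
  have hα : ∑ y, α (rep y) * spin (flip σ x) y =
      ∑ y, α (rep y) * spin σ y - 2 * α (rep x) * spin σ x := by
    simp only [spin_flip, mul_sub, Finset.sum_sub_distrib, mul_ite, mul_zero, Finset.sum_ite_eq',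
      Finset.mem_univ, if_true]
    ring
  have hxx : kac J x x = (1 / (n : ℝ)) ^ d * J 0 := by
    unfold kac
    rw [pos_sub, sub_self]
  have havg : avg σ (fun r => J (pos x - r)) = ∑ z, kac J x z * spin σ z := by
    unfold avg kac
    rw [Finset.mul_sum]
    exact Finset.sum_congr rfl fun z _ => by rw [pos_sub]; ring
  unfold hamiltonian localField
  rw [hS, hα, hxx, havg]
  ring

/-- $e^{-u}/(2\cosh u)=(1-\tanh u)/2$, and since $\tanh$ is odd the sign $\sigma(x)$ comes out of
it. -/
theorem rate_eq (hJ : ∀ r, J (-r) = J r) (σ : Config d n) (x : Lattice d n) :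
    rate J θ α x σ = (1 - spin σ x * Real.tanh (localField J θ α σ x)) / 2 := by
  have h : ∀ u : ℝ, Real.exp (-u) / (2 * Real.cosh u) = (1 - Real.tanh u) / 2 := fun u => by
    have := (Real.cosh_pos u).ne'
    rw [Real.tanh_eq_sinh_div_cosh, ← Real.cosh_sub_sinh]
    field_simp
  unfold rate
  rw [hamiltonian_flip_sub hJ, neg_mul, ← mul_assoc, one_div_mul_cancel two_ne_zero, one_mul, h]
  rcases spin_eq σ x with hs | hs <;> simp [hs]

theorem rate_mem_Icc (hJ : ∀ r, J (-r) = J r) (σ : Config d n) (x : Lattice d n) :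
    rate J θ α x σ ∈ Icc (0 : ℝ) 1 := by
  have h := abs_lt.1 (Real.abs_tanh_lt_one (localField J θ α σ x))
  rw [rate_eq hJ]
  rcases spin_eq σ x with hs | hs <;> rw [hs] <;> constructor <;> linarith

/-- A flip at $x$ changes the average by $-2\gamma^d\sigma(x)G(\gamma x)$. Multiplied by the rate
$(1-\sigma(x)\tanh)/2$, the spin in front of $\tanh$ disappears because $\sigma(x)^2=1$. -/
theorem generator_avg (hJ : ∀ r, J (-r) = J r) (G : Torus d → ℝ) (σ : Config d n) :
    generator J θ α (fun τ => avg τ G) σ =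
      -avg σ G + mean fun x => Real.tanh (localField J θ α σ x) * G (pos x) := by
  unfold generator
  simp only [avg_flip, rate_eq hJ]
  unfold avg mean
  rw [← mul_neg, ← mul_add, ← Finset.sum_neg_distrib, ← Finset.sum_add_distrib, Finset.mul_sum]
  refine Finset.sum_congr rfl fun x _ => ?_
  have h := spin_mul_self σ x
  linear_combination (1 / (n : ℝ)) ^ d * G (pos x) * Real.tanh (localField J θ α σ x) * h

theorem abs_generator_avg_le (hJ : ∀ r, J (-r) = J r) {G : Torus d → ℝ} {B : ℝ}
    (hG : ∀ r, |G r| ≤ B) (σ : Config d n) :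
    |generator J θ α (fun τ => avg τ G) σ| ≤ 2 * B := by
  rw [generator_avg hJ]
  have h1 := abs_le.1 (abs_avg_le σ hG)
  have h2 := abs_le.1 (abs_mean_le (u := fun x : Lattice d n =>
    Real.tanh (localField J θ α σ x) * G (pos x)) (B := 1 * B) fun x => by
      rw [abs_mul]
      exact mul_le_mul (Real.abs_tanh_lt_one _).le (hG _) (abs_nonneg _) zero_le_one)
  rw [abs_le]
  constructor <;> linarith

/-- There are $\gamma^{-d}$ sites, each contributing at most $4B^2\gamma^{2d}$. This makes the noise
vanish in the limit. -/
theorem sum_rate_mul_sq_avg_le (hJ : ∀ r, J (-r) = J r) {G : Torus d → ℝ} {B : ℝ}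
    (hG : ∀ r, |G r| ≤ B) (σ : Config d n) :
    ∑ x, rate J θ α x σ * (avg (flip σ x) G - avg σ G) ^ 2 ≤ 4 * B ^ 2 * (1 / (n : ℝ)) ^ d := by
  calc ∑ x, rate J θ α x σ * (avg (flip σ x) G - avg σ G) ^ 2
      ≤ ∑ x : Lattice d n, (1 / (n : ℝ)) ^ d * (4 * B ^ 2 * (1 / (n : ℝ)) ^ d) := by
        refine Finset.sum_le_sum fun x _ => ?_
        have h1 := rate_mem_Icc (θ := θ) (α := α) hJ σ x
        rw [avg_flip]
        have h2 : (G (pos x)) ^ 2 ≤ B ^ 2 := sq_le_sq' (abs_le.1 (hG _)).1 (abs_le.1 (hG _)).2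
        have h3 : (-(2 * (1 / (n : ℝ)) ^ d * spin σ x * G (pos x))) ^ 2 =
            (1 / (n : ℝ)) ^ d * (4 * G (pos x) ^ 2 * (1 / (n : ℝ)) ^ d) := by
          linear_combination 4 * ((1 / (n : ℝ)) ^ d) ^ 2 * G (pos x) ^ 2 * spin_mul_self σ x
        rw [h3]
        refine (mul_le_of_le_one_left (by positivity) h1.2).trans ?_
        gcongr
    _ = 4 * B ^ 2 * (1 / (n : ℝ)) ^ d := by
        rw [← Finset.mul_sum]
        exact mean_const _

end

section

variable {d N : ℕ}

/-! ### The limiting equation as an ordinary differential equation in `C(Λ)` -/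

/-- The test functions `J(r - ·)`. -/
def shift (J : C(Torus d, ℝ)) : C(Torus d, C(Torus d, ℝ)) :=
  ContinuousMap.curry ⟨fun q : Torus d × Torus d => J (q.1 - q.2), by fun_prop⟩

@[simp] theorem shift_apply (J : C(Torus d, ℝ)) (r r' : Torus d) :
    shift J r r' = J (r - r') := rfl

theorem conv_eq (J : C(Torus d, ℝ)) (f : Torus d → ℝ) (r : Torus d) :
    conv J f r = ∫ r', f r' * shift J r r' := by
  unfold conv
  exact integral_congr_ae (Eventually.of_forall fun r' => mul_comm _ _)

theorem norm_shift_le (J : C(Torus d, ℝ)) (r : Torus d) : ‖shift J r‖ ≤ ‖J‖ :=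
  (ContinuousMap.norm_le _ (norm_nonneg J)).2 fun r' => J.norm_coe_le_norm (r - r')

theorem continuous_conv (J f : C(Torus d, ℝ)) : Continuous (conv J f) := by
  have h := continuous_parametric_integral_of_continuous (μ := (volume : Measure (Torus d)))
    (f := fun r r' => J (r - r') * f r') (by fun_prop) isCompact_univ
  simp only [Measure.restrict_univ] at h
  exact h

theorem integrable_mul_of_bounded {f : Torus d → ℝ} (hf : Measurable f) {B : ℝ}
    (hB : ∀ᵐ r, |f r| ≤ B) (G : C(Torus d, ℝ)) : Integrable (fun r => f r * G r) :=
  (Integrable.of_bound hf.aestronglyMeasurable B hB).mul_bdd G.continuous.aestronglyMeasurable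
    (Eventually.of_forall G.norm_coe_le_norm)

theorem abs_conv_sub_le (J f g : C(Torus d, ℝ)) (r : Torus d) :
    |conv J f r - conv J g r| ≤ ‖J‖ * ‖f - g‖ := by
  rw [conv_eq, conv_eq, ← integral_sub (integrable_of_continuous (by fun_prop))
    (integrable_of_continuous (by fun_prop)), mul_comm]
  simp only [← sub_mul]
  exact abs_integral_mul_le (f := fun r => f r - g r)
    (Eventually.of_forall fun r' => (f - g).norm_coe_le_norm r')
    fun r' => J.norm_coe_le_norm (r - r')

/-- The function `∑ᵢ pᵢ tanh (J * m + aᵢ θ)`. -/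
def drift (J : C(Torus d, ℝ)) (θ : ℝ) (a p : Fin N → ℝ) (m : C(Torus d, ℝ)) : C(Torus d, ℝ) :=
  ⟨fun r => ∑ i, p i * Real.tanh (conv J m r + a i * θ), by
    have := continuous_conv J m
    have := continuous_tanh
    fun_prop⟩

variable {J : C(Torus d, ℝ)} {θ : ℝ} {a p : Fin N → ℝ}

theorem drift_apply (m : C(Torus d, ℝ)) (r : Torus d) :
    drift J θ a p m r = ∑ i, p i * Real.tanh (conv J m r + a i * θ) := rfl

theorem abs_sum_mul_le (hp : ∀ i, 0 ≤ p i) (hp_sum : ∑ i, p i = 1) {u : Fin N → ℝ} {B : ℝ}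
    (hu : ∀ i, |u i| ≤ B) : |∑ i, p i * u i| ≤ B := by
  calc |∑ i, p i * u i| ≤ ∑ i, |p i * u i| := Finset.abs_sum_le_sum_abs _ _
    _ ≤ ∑ i, p i * B := by
        refine Finset.sum_le_sum fun i _ => ?_
        rw [abs_mul, abs_of_nonneg (hp i)]
        exact mul_le_mul_of_nonneg_left (hu i) (hp i)
    _ = B := by rw [← Finset.sum_mul, hp_sum, one_mul]

theorem norm_drift_le (hp : ∀ i, 0 ≤ p i) (hp_sum : ∑ i, p i = 1) (m : C(Torus d, ℝ)) :
    ‖drift J θ a p m‖ ≤ 1 :=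
  (ContinuousMap.norm_le _ zero_le_one).2 fun _ =>
    abs_sum_mul_le hp hp_sum fun _ => (Real.abs_tanh_lt_one _).le

theorem norm_drift_sub_le (hp : ∀ i, 0 ≤ p i) (hp_sum : ∑ i, p i = 1) (m m' : C(Torus d, ℝ)) :
    ‖drift J θ a p m - drift J θ a p m'‖ ≤ ‖J‖ * ‖m - m'‖ := by
  refine (ContinuousMap.norm_le _ (by positivity)).2 fun r => ?_
  rw [ContinuousMap.sub_apply, drift_apply, drift_apply, ← Finset.sum_sub_distrib]
  simp only [← mul_sub]
  refine abs_sum_mul_le hp hp_sum fun i => (abs_tanh_sub_tanh_le _ _).trans ?_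
  rw [add_sub_add_right_eq_sub]
  exact abs_conv_sub_le J m m' r

/-- The vector field of the limiting equation for the unknown `eᵗ m(t)`. -/
def expField (J : C(Torus d, ℝ)) (θ : ℝ) (a p : Fin N → ℝ) (t : ℝ) (n : C(Torus d, ℝ)) :
    C(Torus d, ℝ) :=
  Real.exp t • drift J θ a p (Real.exp (-t) • n)

/-- The factors $e^t$ and $e^{-t}$ cancel, so the Lipschitz constant is uniform in time. -/
theorem lipschitzWith_expField (hp : ∀ i, 0 ≤ p i) (hp_sum : ∑ i, p i = 1) (t : ℝ) :
    LipschitzWith ‖J‖₊ (expField J θ a p t) := by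
  refine LipschitzWith.of_dist_le_mul fun n n' => ?_
  rw [dist_eq_norm, dist_eq_norm, expField, expField, ← smul_sub, norm_smul, Real.norm_eq_abs,
    Real.abs_exp]
  calc Real.exp t * ‖drift J θ a p (Real.exp (-t) • n) - drift J θ a p (Real.exp (-t) • n')‖
      ≤ Real.exp t * (‖J‖ * ‖Real.exp (-t) • n - Real.exp (-t) • n'‖) := by
        gcongr; exact norm_drift_sub_le hp hp_sum _ _
    _ = Real.exp t * Real.exp (-t) * (‖J‖ * ‖n - n'‖) := by
        rw [← smul_sub, norm_smul, Real.norm_eq_abs, Real.abs_exp]; ring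
    _ = ‖J‖₊ * ‖n - n'‖ := by rw [← Real.exp_add, add_neg_cancel, Real.exp_zero, one_mul]; rfl

theorem norm_expField_le (hp : ∀ i, 0 ≤ p i) (hp_sum : ∑ i, p i = 1) (t : ℝ)
    (n : C(Torus d, ℝ)) : ‖expField J θ a p t n‖ ≤ Real.exp t := by
  rw [expField, norm_smul, Real.norm_eq_abs, Real.abs_exp]
  exact mul_le_of_le_one_right (Real.exp_pos t).le (norm_drift_le hp hp_sum _)

theorem continuous_expField (hp : ∀ i, 0 ≤ p i) (hp_sum : ∑ i, p i = 1) (n : C(Torus d, ℝ)) :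
    Continuous fun t => expField J θ a p t n := by
  have h : LipschitzWith ‖J‖₊ (drift J θ a p) := LipschitzWith.of_dist_le_mul fun m m' => by
    rw [dist_eq_norm, dist_eq_norm]; exact norm_drift_sub_le hp hp_sum m m'
  have := h.continuous
  unfold expField
  fun_prop

theorem exists_solution_Icc (hp : ∀ i, 0 ≤ p i) (hp_sum : ∑ i, p i = 1) (m₀ : C(Torus d, ℝ))
    {T : ℝ} (hT : 0 ≤ T) :
    ∃ n : ℝ → C(Torus d, ℝ), n 0 = m₀ ∧
      ∀ t ∈ Ioo (-T) T, HasDerivAt n (expField J θ a p t (n t)) t := by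
  -- The field is bounded by $e^T$ on the whole space for times up to $T$, so a ball of radius
  -- $Te^T$ is never left and the solution exists on all of $[-T,T]$.
  have hf : IsPicardLindelof (expField J θ a p) (tmin := -T) (tmax := T)
      ⟨0, by constructor <;> linarith⟩ m₀ ⟨T * Real.exp T, by positivity⟩ 0
      ⟨Real.exp T, by positivity⟩ ‖J‖₊ :=
    { lipschitzOnWith := fun t _ => (lipschitzWith_expField hp hp_sum t).lipschitzOnWith
      continuousOn := fun n _ => (continuous_expField hp hp_sum n).continuousOn
      norm_le := fun t ht n _ => (norm_expField_le hp hp_sum t n).trans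
        (Real.exp_le_exp.2 ht.2)
      mul_max_le := by
        simp [mul_comm]
        exact le_refl (T * Real.exp T) }
  obtain ⟨n, h0, hn⟩ := hf.exists_eq_forall_mem_Icc_hasDerivWithinAt₀
  exact ⟨n, h0, fun t ht => (hn t (Ioo_subset_Icc_self ht)).hasDerivAt (Icc_mem_nhds ht.1 ht.2)⟩

theorem exists_solution (hp : ∀ i, 0 ≤ p i) (hp_sum : ∑ i, p i = 1) (m₀ : C(Torus d, ℝ)) :
    ∃ n : ℝ → C(Torus d, ℝ), n 0 = m₀ ∧ ∀ t, HasDerivAt n (expField J θ a p t (n t)) t := by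
  choose n h0 hn using fun k : ℕ =>
    exists_solution_Icc (J := J) (θ := θ) (a := a) hp hp_sum m₀ (T := (k : ℝ) + 1) (by positivity)
  have heq : ∀ k l : ℕ, k ≤ l → EqOn (n k) (n l) (Ioo (-((k : ℝ) + 1)) (k + 1)) := by
    intro k l hkl
    have hkl' : (k : ℝ) ≤ l := by exact_mod_cast hkl
    refine ODE_solution_unique_of_mem_Ioo (v := expField J θ a p) (s := fun _ => univ) (t₀ := 0)
      (K := ‖J‖₊) (fun t _ => (lipschitzWith_expField hp hp_sum t).lipschitzOnWith)
      (by constructor <;> linarith [(Nat.cast_nonneg k : (0 : ℝ) ≤ k)])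
      (fun t ht => ⟨hn k t ht, mem_univ _⟩)
      (fun t ht => ⟨hn l t ⟨by linarith [ht.1], by linarith [ht.2]⟩, mem_univ _⟩)
      (by rw [h0, h0])
  -- The `k`-th solution lives on $(-(k+1),k+1)$, so `t` is interior to the interval used at `t`. By
  -- uniqueness the local solutions agree where they overlap.
  refine ⟨fun t => n ⌈|t|⌉₊ t, ?_, fun t => ?_⟩
  · simp [h0]
  · have hmem : ∀ (s : ℝ) (k : ℕ), ⌈|s|⌉₊ ≤ k → s ∈ Ioo (-((k : ℝ) + 1)) (k + 1) := by
      intro s k hk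
      have h1 : |s| ≤ k := (Nat.le_ceil _).trans (by exact_mod_cast hk)
      have := abs_le.1 h1
      constructor <;> linarith
    set k := ⌈|t|⌉₊ + 1 with hk
    have hev : (fun s => n ⌈|s|⌉₊ s) =ᶠ[𝓝 t] n k := by
      have h1 : ∀ᶠ s in 𝓝 t, |s| < |t| + 1 :=
        (continuous_abs.tendsto t).eventually_lt_const (by linarith)
      filter_upwards [h1] with s hs
      have h2 : ⌈|s|⌉₊ ≤ k := by
        rw [Nat.ceil_le, hk]
        push_cast
        linarith [Nat.le_ceil |t|]
      exact heq _ _ h2 (hmem s _ le_rfl)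
    have h3 := (hn k t (hmem t k (by omega))).congr_of_eventuallyEq hev
    rwa [← hev.eq_of_nhds] at h3

/-- The limiting equation has a global solution in `C(Λ)`. -/
theorem exists_global_solution (hp : ∀ i, 0 ≤ p i) (hp_sum : ∑ i, p i = 1) {m₀ : C(Torus d, ℝ)}
    (hm₀ : ‖m₀‖ ≤ 1) :
    ∃ m : ℝ → C(Torus d, ℝ), m 0 = m₀ ∧ (∀ t, HasDerivAt m (-m t + drift J θ a p (m t)) t) ∧
      ∀ t, 0 ≤ t → ‖m t‖ ≤ 1 := by
  obtain ⟨n, h0, hn⟩ := exists_solution (J := J) (θ := θ) (a := a) hp hp_sum m₀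
  refine ⟨fun t => Real.exp (-t) • n t, by simp [h0], fun t => ?_, fun t ht => ?_⟩
  · have h1 := (hasDerivAt_neg t).exp.smul (hn t)
    have e : -(Real.exp (-t) • n t) + drift J θ a p (Real.exp (-t) • n t) =
        Real.exp (-t) • expField J θ a p t (n t) + (Real.exp (-t) * -1) • n t := by
      simp only [expField, smul_smul, ← Real.exp_add, neg_add_cancel, Real.exp_zero, one_smul]
      module
    rw [e]
    exact h1
  -- The derivative of $e^tm(t)$ has norm at most $e^t$ and its initial norm is at most $1=e^0$, so
  -- comparison with $e^t$ gives $\|m(t)\|\le1$.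
  · have h1 : ‖n t‖ ≤ Real.exp t := by
      refine image_norm_le_of_norm_deriv_right_le_deriv_boundary (a := 0) (b := t)
        (f' := fun s => expField J θ a p s (n s)) (B := Real.exp) (B' := Real.exp)
        (fun s _ => (hn s).continuousAt.continuousWithinAt)
        (fun s _ => (hn s).hasDerivWithinAt) ?_ (fun s => Real.hasDerivAt_exp s)
        (fun s _ => norm_expField_le hp hp_sum s _) ⟨ht, le_rfl⟩
      rw [h0, Real.exp_zero]
      exact hm₀
    rw [norm_smul, Real.norm_eq_abs, Real.abs_exp]
    calc Real.exp (-t) * ‖n t‖ ≤ Real.exp (-t) * Real.exp t := by gcongr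
      _ = 1 := by rw [← Real.exp_add, neg_add_cancel, Real.exp_zero]

end

section

variable {d N : ℕ}

/-! ### Weak solutions: existence and uniqueness -/

theorem integrable_uncurry_of_bounded {F : ℝ → Torus d → ℝ} (hF : Measurable (Function.uncurry F))
    {t B : ℝ} (hB : ∀ s ∈ Ioc 0 t, ∀ᵐ r, |F s r| ≤ B) :
    Integrable (Function.uncurry F)
      ((volume.restrict (Ioc 0 t)).prod (volume : Measure (Torus d))) := by
  refine Integrable.of_bound hF.aestronglyMeasurable B ?_
  have hmeas : MeasurableSet {q : ℝ × Torus d | ‖Function.uncurry F q‖ ≤ B} :=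
    measurableSet_le hF.norm measurable_const
  refine (Measure.ae_prod_iff_ae_ae hmeas).2 ?_
  filter_upwards [ae_restrict_mem measurableSet_Ioc] with s hs using hB s hs

theorem intervalIntegrable_integral {F : ℝ → Torus d → ℝ} (hF : Measurable (Function.uncurry F))
    {t B : ℝ} (ht : 0 ≤ t) (hB : ∀ s ∈ Ioc 0 t, ∀ᵐ r, |F s r| ≤ B) :
    IntervalIntegrable (fun s => ∫ r, F s r) volume 0 t := by
  rw [intervalIntegrable_iff, uIoc_of_le ht]
  exact (integrable_uncurry_of_bounded hF hB).integral_prod_left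

theorem intervalIntegral_integral_swap {F : ℝ → Torus d → ℝ}
    (hF : Measurable (Function.uncurry F)) {t B : ℝ} (ht : 0 ≤ t)
    (hB : ∀ s ∈ Ioc 0 t, ∀ᵐ r, |F s r| ≤ B) :
    ∫ s in (0 : ℝ)..t, ∫ r, F s r = ∫ r, ∫ s in (0 : ℝ)..t, F s r := by
  simp only [intervalIntegral.integral_of_le ht]
  exact integral_integral_swap (integrable_uncurry_of_bounded hF hB)

theorem measurable_conv {J : C(Torus d, ℝ)} {m : ℝ → Torus d → ℝ}
    (hm : Measurable (Function.uncurry m)) :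
    Measurable fun q : ℝ × Torus d => conv J (m q.1) q.2 := by
  have h : Measurable fun q : (ℝ × Torus d) × Torus d => J (q.1.2 - q.2) * m q.1.1 q.2 :=
    (J.continuous.measurable.comp (by fun_prop)).mul
      (hm.comp ((measurable_fst.comp measurable_fst).prodMk measurable_snd))
  exact h.stronglyMeasurable.integral_prod_right.measurable

theorem measurable_field {J : C(Torus d, ℝ)} {θ : ℝ} {a p : Fin N → ℝ} {m : ℝ → Torus d → ℝ}
    (hm : Measurable (Function.uncurry m)) :
    Measurable (Function.uncurry fun s r =>
      ∑ i, p i * Real.tanh (conv J (m s) r + a i * θ)) :=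
  Finset.measurable_sum _ fun _ _ => measurable_const.mul
    (continuous_tanh.measurable.comp ((measurable_conv hm).add_const _))

theorem exists_bound_Icc {F : ℝ → Torus d → ℝ} (hF : Continuous (Function.uncurry F)) (t : ℝ) :
    ∃ B, ∀ s ∈ Icc 0 t, ∀ r, |F s r| ≤ B := by
  obtain ⟨B, hB⟩ := ((isCompact_Icc (a := (0 : ℝ)) (b := t)).prod
    (isCompact_univ (X := Torus d))).exists_bound_of_continuousOn hF.continuousOn
  exact ⟨B, fun s hs r => hB (s, r) ⟨hs, mem_univ _⟩⟩

/-- A `C¹` curve in `C(Λ)` that solves the limiting equation is a weak solution. -/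
theorem isWeakSolution_of_hasDerivAt {J : C(Torus d, ℝ)} {θ : ℝ} {a p : Fin N → ℝ}
    {m₀ : C(Torus d, ℝ)} {u : ℝ → C(Torus d, ℝ)} (h0 : u 0 = m₀)
    (hu : ∀ t, HasDerivAt u (-u t + drift J θ a p (u t)) t) :
    IsWeakSolution J θ a p m₀ fun t r => u t r := by
  have hc : Continuous u := continuous_iff_continuousAt.2 fun t => (hu t).continuousAt
  have hcu : Continuous (Function.uncurry fun t r => u t r) := by
    simp only [Function.uncurry_def]
    fun_prop
  have hm : Measurable (Function.uncurry fun t r => u t r) := hcu.measurable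
  refine ⟨hm, fun T => ?_, fun G G' hG hG' hGG' t ht => ?_⟩
  · obtain ⟨B, hB⟩ := exists_bound_Icc hcu T
    exact ⟨B, fun s hs => Eventually.of_forall (hB s hs)⟩
  obtain ⟨B, hB⟩ := exists_bound_Icc hcu t
  obtain ⟨D, hD⟩ := exists_bound_Icc hG t
  obtain ⟨D', hD'⟩ := exists_bound_Icc hG' t
  obtain ⟨Ψ, hΨ⟩ : ∃ Ψ : ℝ → Torus d → ℝ, Ψ = fun s r =>
    ∑ i, p i * Real.tanh (conv J (u s) r + a i * θ) := ⟨_, rfl⟩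
  have hup : ∀ r s, HasDerivAt (fun s => u s r) (-u s r + Ψ s r) s := fun r s => by
    rw [hΨ]
    exact (ContinuousMap.evalCLM ℝ r : C(Torus d, ℝ) →L[ℝ] ℝ).hasFDerivAt.comp_hasDerivAt s (hu s)
  have hΨm : Measurable (Function.uncurry Ψ) := by
    rw [hΨ]
    exact measurable_field (m := fun t r => u t r) hm
  obtain ⟨E, hE⟩ : ∃ E : ℝ, ∀ s r, |Ψ s r| ≤ E := by
    refine ⟨∑ i, |p i|, fun s r => ?_⟩
    rw [hΨ]
    refine (Finset.abs_sum_le_sum_abs _ _).trans (Finset.sum_le_sum fun i _ => ?_)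
    rw [abs_mul]
    exact mul_le_of_le_one_right (abs_nonneg _) (Real.abs_tanh_lt_one _).le
  have hF1m : Measurable (Function.uncurry fun s r => (-u s r + Ψ s r) * G s r) :=
    (hm.neg.add hΨm).mul hG.measurable
  have hF2m : Measurable (Function.uncurry fun s r => u s r * G' s r) := hm.mul hG'.measurable
  have hF1b : ∀ s ∈ Ioc 0 t, ∀ r, |(-u s r + Ψ s r) * G s r| ≤ (B + E) * D := by
    intro s hs r
    have hs' := Ioc_subset_Icc_self hs
    rw [abs_mul]
    have h1 := abs_add_le (-u s r) (Ψ s r)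
    rw [abs_neg] at h1
    exact mul_le_mul (h1.trans (add_le_add (hB s hs' r) (hE s r))) (hD s hs' r) (abs_nonneg _)
      ((abs_nonneg _).trans (h1.trans (add_le_add (hB s hs' r) (hE s r))))
  have hF2b : ∀ s ∈ Ioc 0 t, ∀ r, |u s r * G' s r| ≤ B * D' := by
    intro s hs r
    have hs' := Ioc_subset_Icc_self hs
    rw [abs_mul]
    exact mul_le_mul (hB s hs' r) (hD' s hs' r) (abs_nonneg _) ((abs_nonneg _).trans (hB s hs' r))
  have hint1 : ∀ r, IntervalIntegrable (fun s => (-u s r + Ψ s r) * G s r) volume 0 t := fun r => by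
    rw [intervalIntegrable_iff, uIoc_of_le ht]
    refine Integrable.of_bound (hF1m.comp (measurable_id.prodMk measurable_const)).aestronglyMeasurable
      ((B + E) * D) ?_
    filter_upwards [ae_restrict_mem measurableSet_Ioc] with s hs using hF1b s hs r
  have hint2 : ∀ r, IntervalIntegrable (fun s => u s r * G' s r) volume 0 t := fun r => by
    rw [intervalIntegrable_iff, uIoc_of_le ht]
    refine Integrable.of_bound (hF2m.comp (measurable_id.prodMk measurable_const)).aestronglyMeasurable
      (B * D') ?_
    filter_upwards [ae_restrict_mem measurableSet_Ioc] with s hs using hF2b s hs r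
  -- The weak form at a single point `r` is the product rule for `u s r * G s r`; integration over
  -- `r` and Fubini give the rest.
  have hftc : ∀ r, (∫ s in (0 : ℝ)..t, (-u s r + Ψ s r) * G s r) +
      ∫ s in (0 : ℝ)..t, u s r * G' s r = u t r * G t r - m₀ r * G 0 r := fun r => by
    rw [← intervalIntegral.integral_add (hint1 r) (hint2 r), ← h0]
    exact intervalIntegral.integral_eq_sub_of_hasDerivAt (f := fun s => u s r * G s r)
      (fun s _ => (hup r s).mul (hGG' s r)) ((hint1 r).add (hint2 r))
  have hGc : ∀ s, Continuous (G s) := fun s =>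
    hG.comp (continuous_const.prodMk continuous_id)
  have hrhs : (∫ s in (0 : ℝ)..t, ∫ r, (-u s r + ∑ i, p i * Real.tanh
      (conv J (u s) r + a i * θ)) * G s r) = ∫ s in (0 : ℝ)..t, ∫ r, (-u s r + Ψ s r) * G s r := by
    rw [hΨ]
  clear hΨ
  rw [hrhs]
  rw [intervalIntegral_integral_swap hF1m ht fun s hs => Eventually.of_forall (hF1b s hs),
    intervalIntegral_integral_swap hF2m ht fun s hs => Eventually.of_forall (hF2b s hs),
    sub_eq_iff_eq_add, ← integral_add, ← integral_sub]
  · exact integral_congr_ae (Eventually.of_forall fun r => (hftc r).symm)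
  · exact integrable_of_continuous ((u t).continuous.mul (hGc t))
  · exact integrable_of_continuous (m₀.continuous.mul (hGc 0))
  · simp only [intervalIntegral.integral_of_le ht]
    exact (integrable_uncurry_of_bounded hF1m
      fun s hs => Eventually.of_forall (hF1b s hs)).integral_prod_right
  · simp only [intervalIntegral.integral_of_le ht]
    exact (integrable_uncurry_of_bounded hF2m
      fun s hs => Eventually.of_forall (hF2b s hs)).integral_prod_right

/-- For continuous $g$ the hypothesis gives $\int f^2=\int f(f-g)$, which is small when $g$ is close
to the bounded function $f$ in $L^1$. -/
theorem ae_eq_zero_of_forall_integral_mul_eq_zero {f : Torus d → ℝ} (hf : Measurable f) {B : ℝ}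
    (hB : ∀ᵐ r, |f r| ≤ B) (h : ∀ G : C(Torus d, ℝ), ∫ r, f r * G r = 0) :
    f =ᵐ[volume] 0 := by
  have hint : Integrable f := Integrable.of_bound hf.aestronglyMeasurable B hB
  have hint2 : Integrable fun r => f r * f r := hint.mul_bdd hf.aestronglyMeasurable hB
  have hle : ∫ r, f r * f r ≤ 0 := by
    refine le_of_forall_pos_le_add fun ε hε => ?_
    have hB1 : 0 < |B| + 1 := by positivity
    obtain ⟨g, hg, -⟩ := hint.exists_boundedContinuous_integral_sub_le
      (ε := ε / (|B| + 1)) (by positivity)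
    have hgi := integrable_of_continuous g.continuous
    have hfg : Integrable fun r => f r * g r :=
      integrable_mul_of_bounded hf hB (g : C(Torus d, ℝ))
    have hfg0 : ∫ r, f r * g r = 0 := h (g : C(Torus d, ℝ))
    have hdiff : Integrable fun r => f r * (f r - g r) := by
      simp only [mul_sub]
      exact hint2.sub hfg
    have h1 : ∫ r, f r * f r = ∫ r, f r * (f r - g r) := by
      simp only [mul_sub]
      rw [integral_sub hint2 hfg, hfg0, sub_zero]
    rw [h1, zero_add]
    calc ∫ r, f r * (f r - g r) ≤ ∫ r, (|B| + 1) * ‖f r - g r‖ := by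
          refine integral_mono_ae hdiff ((hint.sub hgi).norm.const_mul _) ?_
          filter_upwards [hB] with r hr
          refine (le_abs_self _).trans ?_
          rw [abs_mul]
          exact mul_le_mul_of_nonneg_right (by linarith [le_abs_self B]) (abs_nonneg _)
      _ ≤ (|B| + 1) * (ε / (|B| + 1)) := by
          rw [integral_const_mul]
          gcongr
      _ = ε := by field_simp
  have h0 : ∫ r, f r * f r = 0 :=
    le_antisymm hle (integral_nonneg fun r => mul_self_nonneg _)
  rw [integral_eq_zero_iff_of_nonneg (fun r => mul_self_nonneg _) hint2] at h0
  filter_upwards [h0] with r hr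
  simpa using hr

/-- Grönwall for the difference of the two solutions tested on a ball of $C(\Lambda)$. No continuity
in time is known beforehand, whence the form of `abs_le_of_forall_abs_le_exp`. -/
theorem IsWeakSolution.ae_eq {J : C(Torus d, ℝ)} {θ : ℝ} {a p : Fin N → ℝ}
    (hp : ∀ i, 0 ≤ p i) (hp_sum : ∑ i, p i = 1) {m₀ : Torus d → ℝ} {m m' : ℝ → Torus d → ℝ}
    (hm : IsWeakSolution J θ a p m₀ m) (hm' : IsWeakSolution J θ a p m₀ m') {t : ℝ} (ht : 0 ≤ t) :
    m' t =ᵐ[volume] m t := by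
  obtain ⟨B, hB⟩ := hm.bounded t
  obtain ⟨B', hB'⟩ := hm'.bounded t
  have hms : ∀ {v : ℝ → Torus d → ℝ}, Measurable (Function.uncurry v) → ∀ s, Measurable (v s) :=
    fun hv s => hv.comp (measurable_const.prodMk measurable_id)
  let L : ℝ → C(Torus d, ℝ) → ℝ := fun s G => (∫ r, m' s r * G r) - ∫ r, m s r * G r
  let Ψ : (ℝ → Torus d → ℝ) → ℝ → Torus d → ℝ :=
    fun v s r => ∑ i, p i * Real.tanh (conv J (v s) r + a i * θ)
  have hΨb : ∀ v s r, |Ψ v s r| ≤ 1 := fun v s r =>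
    abs_sum_mul_le hp hp_sum fun _ => (Real.abs_tanh_lt_one _).le
  have hΨm : ∀ {v : ℝ → Torus d → ℝ}, Measurable (Function.uncurry v) →
      Measurable (Function.uncurry (Ψ v)) := fun hv => measurable_field hv
  have hfm : ∀ {v : ℝ → Torus d → ℝ}, Measurable (Function.uncurry v) → ∀ G : C(Torus d, ℝ),
      Measurable (Function.uncurry fun s r => (-v s r + Ψ v s r) * G r) := fun hv G =>
    (hv.neg.add (hΨm hv)).mul (G.continuous.measurable.comp measurable_snd)
  have hfb : ∀ {v : ℝ → Torus d → ℝ} {D : ℝ}, (∀ s ∈ Icc 0 t, ∀ᵐ r, |v s r| ≤ D) →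
      ∀ G : C(Torus d, ℝ), ∀ s ∈ Ioc 0 t, ∀ᵐ r, |(-v s r + Ψ v s r) * G r| ≤ (D + 1) * ‖G‖ := by
    intro v D hv G s hs
    filter_upwards [hv s (Ioc_subset_Icc_self hs)] with r hr
    have h1 := abs_add_le (-v s r) (Ψ v s r)
    rw [abs_neg] at h1
    rw [abs_mul]
    have h2 := (h1.trans (add_le_add hr (hΨb v s r)))
    exact mul_le_mul h2 (G.norm_coe_le_norm r) (abs_nonneg _) ((abs_nonneg _).trans h2)
  have heq : ∀ {v : ℝ → Torus d → ℝ}, IsWeakSolution J θ a p m₀ v → ∀ G : C(Torus d, ℝ), ∀ s,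
      0 ≤ s → ∫ r, v s r * G r = (∫ r, m₀ r * G r) +
        ∫ u in (0 : ℝ)..s, ∫ r, (-v u r + Ψ v u r) * G r := fun hv G s hs => by
    have h := hv.equation (fun _ r => G r) (fun _ _ => 0) (by fun_prop) (by fun_prop)
      (fun s r => hasDerivAt_const s (G r)) s hs
    simp only [mul_zero, integral_zero, intervalIntegral.integral_zero, sub_zero] at h
    linarith
  -- The nonlinear term sees the solutions only through $J*m$, that is, through the test functions
  -- $J(r-\cdot)$.
  have hdiff : ∀ s ∈ Icc 0 t, ∀ G : C(Torus d, ℝ), ∀ K : ℝ,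
      (∀ r, |L s (shift J r)| ≤ K) → |L s G| ≤ K →
      |(∫ r, (-m' s r + Ψ m' s r) * G r) - ∫ r, (-m s r + Ψ m s r) * G r| ≤ K + K * ‖G‖ := by
    intro s hs G K hJK hGK
    have i1 := integrable_mul_of_bounded (hms hm.measurable s) (hB s hs) G
    have i2 := integrable_mul_of_bounded (hms hm'.measurable s) (hB' s hs) G
    have i3 := integrable_mul_of_bounded (hms (hΨm hm.measurable) s)
      (Eventually.of_forall (hΨb m s)) G
    have i4 := integrable_mul_of_bounded (hms (hΨm hm'.measurable) s)
      (Eventually.of_forall (hΨb m' s)) G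
    have e : (∫ r, (-m' s r + Ψ m' s r) * G r) - ∫ r, (-m s r + Ψ m s r) * G r =
        -L s G + ∫ r, (Ψ m' s r - Ψ m s r) * G r := by
      simp only [add_mul, sub_mul, neg_mul, L]
      rw [integral_add i2.fun_neg i4, integral_add i1.fun_neg i3, integral_sub i4 i3, integral_neg,
        integral_neg]
      ring
    rw [e]
    have h2 : |∫ r, (Ψ m' s r - Ψ m s r) * G r| ≤ K * ‖G‖ := by
      refine abs_integral_mul_le (Eventually.of_forall fun r => ?_) G.norm_coe_le_norm
      simp only [Ψ]
      rw [← Finset.sum_sub_distrib]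
      simp only [← mul_sub]
      refine abs_sum_mul_le hp hp_sum fun i => (abs_tanh_sub_tanh_le _ _).trans ?_
      rw [add_sub_add_right_eq_sub, conv_eq, conv_eq]
      exact hJK r
    have h3 := abs_add_le (-L s G) (∫ r, (Ψ m' s r - Ψ m s r) * G r)
    rw [abs_neg] at h3
    linarith
  -- The ball of radius `R` contains all shifts of $J$, so the estimate `hdiff` closes on it with
  -- constant $1+R$.
  set R := ‖J‖ + 1 with hR
  have hR0 : 0 < R := by positivity
  have hball : ∀ G : C(Torus d, ℝ), ‖G‖ ≤ R → L t G = 0 := by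
    intro G hG
    have key := abs_le_of_forall_abs_le_exp (ι := {G : C(Torus d, ℝ) // ‖G‖ ≤ R})
      (z := fun s G => L s G.1) (T := t) (C := 1 + R) (ε := 0) (B := B' * R + B * R)
      (by positivity) le_rfl ?_ ?_ (t := t) ⟨ht, le_rfl⟩ ⟨G, hG⟩
    · simpa using key
    · rintro s hs ⟨G, hG⟩
      have hGr : ∀ r, |G r| ≤ R := fun r => (G.norm_coe_le_norm r).trans hG
      exact (abs_sub _ _).trans (add_le_add (abs_integral_mul_le (hB' s hs) hGr)
        (abs_integral_mul_le (hB s hs) hGr))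
    · rintro K hK0 hK s hs ⟨G, hG⟩
      have hsub : ∀ {u}, u ∈ Ioc 0 s → u ∈ Icc 0 t := fun hu => ⟨hu.1.le, hu.2.trans hs.2⟩
      have hI : Ioc 0 s ⊆ Ioc 0 t := Ioc_subset_Ioc_right hs.2
      have e : L s G = ∫ u in (0 : ℝ)..s, ((∫ r, (-m' u r + Ψ m' u r) * G r) -
          ∫ r, (-m u r + Ψ m u r) * G r) := by
        rw [intervalIntegral.integral_sub
          (intervalIntegrable_integral (hfm hm'.measurable G) hs.1
            fun u hu => hfb hB' G u (hI hu))
          (intervalIntegrable_integral (hfm hm.measurable G) hs.1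
            fun u hu => hfb hB G u (hI hu))]
        simp only [L]
        rw [heq hm' G s hs.1, heq hm G s hs.1]
        ring
      simp only [zero_add]
      rw [e, ← Real.norm_eq_abs]
      refine intervalIntegral.norm_integral_le_of_norm_le hs.1
        (Eventually.of_forall fun u hu => ?_) (Continuous.intervalIntegrable (by fun_prop) _ _)
      have h1 := hdiff u (hsub hu) G (K * Real.exp (2 * (1 + R) * u))
        (fun r => hK u (hsub hu) ⟨shift J r, (norm_shift_le J r).trans (by linarith)⟩)
        (hK u (hsub hu) ⟨G, hG⟩)
      rw [Real.norm_eq_abs]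
      refine h1.trans ?_
      have h4 : K * Real.exp (2 * (1 + R) * u) * ‖G‖ ≤ K * Real.exp (2 * (1 + R) * u) * R := by
        gcongr
      linarith
  have hall : ∀ G : C(Torus d, ℝ), ∫ r, (m' t r - m t r) * G r = 0 := by
    intro G
    have i1 := integrable_mul_of_bounded (hms hm.measurable t) (hB t ⟨ht, le_rfl⟩) G
    have i2 := integrable_mul_of_bounded (hms hm'.measurable t) (hB' t ⟨ht, le_rfl⟩) G
    have hc : 0 < R / (‖G‖ + 1) := by positivity
    have h1 := hball ((R / (‖G‖ + 1)) • G) (by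
      rw [norm_smul, Real.norm_eq_abs, abs_of_pos hc, div_mul_eq_mul_div, div_le_iff₀ (by positivity)]
      gcongr
      linarith)
    have h2 : L t ((R / (‖G‖ + 1)) • G) = R / (‖G‖ + 1) * L t G := by
      simp only [L, ContinuousMap.smul_apply, smul_eq_mul, mul_left_comm _ (R / (‖G‖ + 1)),
        integral_const_mul, mul_sub]
    rw [h2] at h1
    simp only [sub_mul]
    rw [integral_sub i2 i1]
    exact (mul_eq_zero.1 h1).resolve_left hc.ne'
  have hz := ae_eq_zero_of_forall_integral_mul_eq_zero (f := fun r => m' t r - m t r) (B := B' + B)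
    ((hms hm'.measurable t).sub (hms hm.measurable t)) (by
      filter_upwards [hB t ⟨ht, le_rfl⟩, hB' t ⟨ht, le_rfl⟩] with r h1 h2
      exact (abs_sub _ _).trans (add_le_add h2 h1)) hall
  filter_upwards [hz] with r hr
  exact sub_eq_zero.1 hr

end

section

variable {d N : ℕ}

/-! ### Riemann sums on the torus -/

theorem norm_coe_unitAddCircle_le (x : ℝ) : ‖(x : UnitAddCircle)‖ ≤ |x| := by
  rw [UnitAddCircle.norm_eq]
  have := round_le x 0
  simpa using this

theorem exists_dist_pos_le {n : ℕ} [NeZero n] (r : Torus d) :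
    ∃ x : Lattice d n, ‖r - pos x‖ ≤ 1 / (n : ℝ) := by
  have hn : (0 : ℝ) < n := Nat.cast_pos.2 (NeZero.pos n)
  choose t ht using fun i => QuotientAddGroup.mk_surjective (r i)
  refine ⟨fun i => ((⌊(n : ℝ) * t i⌋ : ℤ) : ZMod n), (pi_norm_le_iff_of_nonneg (by positivity)).2
    fun i => ?_⟩
  have h1 : (r - pos fun i => ((⌊(n : ℝ) * t i⌋ : ℤ) : ZMod n)) i =
      ((t i - (⌊(n : ℝ) * t i⌋ : ℝ) / n : ℝ) : UnitAddCircle) := by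
    rw [Pi.sub_apply, pos, ZMod.toAddCircle_intCast, ← ht i]
    rfl
  rw [h1]
  refine (norm_coe_unitAddCircle_le _).trans ?_
  have h2 := Int.floor_le ((n : ℝ) * t i)
  have h3 := Int.lt_floor_add_one ((n : ℝ) * t i)
  have h4 : t i - (⌊(n : ℝ) * t i⌋ : ℝ) / n = (n * t i - ⌊(n : ℝ) * t i⌋) / n := by
    field_simp
  rw [h4, abs_of_nonneg (div_nonneg (by linarith) hn.le)]
  gcongr
  linarith

theorem mean_add_left {n : ℕ} [NeZero n] (u : Lattice d n → ℝ) (y : Lattice d n) :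
    mean (fun x => u (y + x)) = mean u := by
  unfold mean
  congr 1
  exact Fintype.sum_equiv (Equiv.addLeft y) _ _ fun x => rfl

/-- Averaging the Riemann sum over all translates of the lattice gives exactly $\int G$. Lattice
translations do not change the sum and every $r$ is within $1/n$ of a lattice point, so uniform
continuity bounds the effect of each translate. -/
theorem tendsto_mean_pos (G : C(Torus d, ℝ)) :
    Tendsto (fun k : ℕ => mean fun x : Lattice d (2 * k + 1) => G (pos x)) atTop
      (𝓝 (∫ r, G r)) := by
  refine Metric.tendsto_atTop.2 fun ε hε => ?_
  obtain ⟨δ, hδ, hG⟩ := Metric.uniformContinuous_iff.1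
    (CompactSpace.uniformContinuous_of_continuous G.continuous) (ε / 2) (half_pos hε)
  obtain ⟨K, hK⟩ := exists_nat_one_div_lt hδ
  refine ⟨K, fun k hk => ?_⟩
  have hclose : ∀ r : Torus d, |(mean fun x : Lattice d (2 * k + 1) => G (pos x)) -
      mean fun x : Lattice d (2 * k + 1) => G (r + pos x)| ≤ ε / 2 := by
    intro r
    obtain ⟨y, hy⟩ := exists_dist_pos_le (n := 2 * k + 1) r
    rw [← mean_add_left (fun x : Lattice d (2 * k + 1) => G (pos x)) y, ← mean_sub]
    refine abs_mean_le fun x => ?_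
    have h1 := hG (a := pos (y + x)) (b := r + pos x) (by
      rw [pos_add, dist_comm, dist_eq_norm, add_sub_add_right_eq_sub]
      refine hy.trans_lt (lt_of_le_of_lt ?_ hK)
      push_cast
      have : (K : ℝ) ≤ k := by exact_mod_cast hk
      gcongr
      linarith [(Nat.cast_nonneg k : (0 : ℝ) ≤ k)])
    exact h1.le
  have hint : ∫ r, (mean fun x : Lattice d (2 * k + 1) => G (r + pos x)) = ∫ r, G r := by
    unfold mean
    rw [integral_const_mul, integral_finsetSum _ fun x _ =>
      integrable_of_continuous (by fun_prop)]
    simp only [integral_add_right_eq_self (fun r => G r)]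
    exact mean_const _
  have hcont : Continuous fun r => mean fun x : Lattice d (2 * k + 1) => G (r + pos x) := by
    unfold mean
    fun_prop
  have h2 : (mean fun x : Lattice d (2 * k + 1) => G (pos x)) - ∫ r, G r =
      ∫ r, ((mean fun x : Lattice d (2 * k + 1) => G (pos x)) -
        mean fun x : Lattice d (2 * k + 1) => G (r + pos x)) * 1 := by
    simp only [mul_one]
    rw [integral_sub (integrable_const _) (integrable_of_continuous hcont), hint]
    simp
  rw [Real.dist_eq, h2]
  have h3 := abs_integral_mul_le (Eventually.of_forall hclose) (G := fun _ => 1) (D := 1)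
    fun _ => by simp
  linarith

/-! ### The law of large numbers for the field -/

theorem rep_injective {n : ℕ} [NeZero n] : Function.Injective (rep : Lattice d n → Fin d → ℤ) :=
  fun _ _ h => funext fun i => ZMod.injective_valMinAbs (congrFun h i)

/-- The difference of `γ^d ∑_x 1{α(x) = a} G(γx)` and `p ∫ G`. -/
def fieldError (α : (Fin d → ℤ) → ℝ) (a p : ℝ) (k : ℕ) (G : C(Torus d, ℝ)) : ℝ :=
  (mean fun x : Lattice d (2 * k + 1) => (if α (rep x) = a then 1 else 0) * G (pos x)) -
    p * ∫ r, G r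

theorem abs_fieldError_sub_le (α : (Fin d → ℤ) → ℝ) (a : ℝ) {p : ℝ} (hp0 : 0 ≤ p) (hp1 : p ≤ 1)
    (k : ℕ) (G G' : C(Torus d, ℝ)) :
    |fieldError α a p k G - fieldError α a p k G'| ≤ 2 * dist G G' := by
  have h1 : |mean fun x : Lattice d (2 * k + 1) =>
      (if α (rep x) = a then 1 else 0) * (G - G') (pos x)| ≤ ‖G - G'‖ := by
    refine abs_mean_le fun x => ?_
    have h := (G - G').norm_coe_le_norm (pos x)
    split_ifs
    · simpa using h
    · simp
  have h2 : |∫ r, (G - G') r| ≤ ‖G - G'‖ := by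
    simpa using abs_integral_mul_le (f := G - G') (Eventually.of_forall (G - G').norm_coe_le_norm)
      (G := fun _ => 1) (D := 1) fun _ => by simp
  have h3 : fieldError α a p k G - fieldError α a p k G' =
      (mean fun x : Lattice d (2 * k + 1) =>
        (if α (rep x) = a then 1 else 0) * (G - G') (pos x)) - p * ∫ r, (G - G') r := by
    simp only [fieldError, ContinuousMap.sub_apply, mul_sub]
    rw [mean_sub, integral_sub (integrable_of_continuous G.continuous)
      (integrable_of_continuous G'.continuous)]
    ring
  rw [h3, dist_eq_norm]
  refine (abs_sub _ _).trans ?_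
  rw [abs_mul, abs_of_nonneg hp0]
  have : p * |∫ r, (G - G') r| ≤ 1 * ‖G - G'‖ := by gcongr
  linarith

variable {Ω : Type*} [MeasurableSpace Ω] {μ : Measure Ω} [IsProbabilityMeasure μ]
  {α : (Fin d → ℤ) → Ω → ℝ}

theorem integral_indicator_eq (hα : ∀ x, Measurable (α x)) {a p : ℝ} (hp : 0 ≤ p)
    (hlaw : ∀ x, μ {ω | α x ω = a} = ENNReal.ofReal p) (x : Fin d → ℤ) :
    ∫ ω, (if α x ω = a then (1 : ℝ) else 0) ∂μ = p := by
  have h : (fun ω => if α x ω = a then (1 : ℝ) else 0) = {ω | α x ω = a}.indicator 1 := by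
    ext ω
    simp [indicator_apply]
  have hm : MeasurableSet {ω | α x ω = a} := hα x (measurableSet_singleton a)
  rw [h, integral_indicator_one hm, measureReal_def, hlaw x,
    ENNReal.toReal_ofReal hp]

/-- Hoeffding over the $n^d$ independent sites bounds the bad event by $e^{-cn^d}$, which is
summable; Borel–Cantelli concludes. Nothing is needed about the joint law for different $n$. -/
theorem ae_eventually_mean_lt (hd : 1 ≤ d) (hα : ∀ x, Measurable (α x)) (hind : iIndepFun α μ)
    {a p : ℝ} (hp : 0 ≤ p) (hlaw : ∀ x, μ {ω | α x ω = a} = ENNReal.ofReal p)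
    (G : C(Torus d, ℝ)) {δ : ℝ} (hδ : 0 < δ) :
    ∀ᵐ ω ∂μ, ∀ᶠ k : ℕ in atTop, (mean fun x : Lattice d (2 * k + 1) =>
      ((if α (rep x) ω = a then 1 else 0) - p) * G (pos x)) < δ := by
  set B : ℝ := ‖G‖ + 1 with hB
  have hB0 : 0 < B := by positivity
  have hGB : ∀ r, |G r| ≤ B := fun r => (G.norm_coe_le_norm r).trans (by linarith)
  -- Each summand lies in $[-B,B]$ and has variance proxy $B^2$, so the Hoeffding exponent is
  -- $(\delta n^d)^2/(2n^dB^2)=cn^d$.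
  set c : ℝ := δ ^ 2 / (2 * B ^ 2) with hc
  have hc0 : 0 < c := by positivity
  let s : ℕ → Set Ω := fun k => {ω | δ ≤ mean fun x : Lattice d (2 * k + 1) =>
    ((if α (rep x) ω = a then 1 else 0) - p) * G (pos x)}
  have hs : ∀ k, μ (s k) ≤ ENNReal.ofReal (Real.exp (-c) ^ k) := by
    intro k
    set n : ℕ := 2 * k + 1 with hn
    have hn0 : (0 : ℝ) < (n : ℝ) ^ d := by positivity
    let Y : Lattice d n → Ω → ℝ := fun x ω => (if α (rep x) ω = a then 1 else 0) * G (pos x)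
    have hYm : ∀ x, Measurable (Y x) := fun x =>
      (Measurable.ite (hα _ (measurableSet_singleton a)) measurable_const
        measurable_const).mul_const _
    have hYint : ∀ x, ∫ ω, Y x ω ∂μ = p * G (pos x) := fun x => by
      simp only [Y]
      rw [integral_mul_const, integral_indicator_eq hα hp hlaw]
    have hsubG : ∀ x, HasSubgaussianMGF (fun ω => Y x ω - ∫ ω', Y x ω' ∂μ)
        ((‖B - (-B)‖₊ / 2) ^ 2) μ := fun x => by
      refine hasSubgaussianMGF_of_mem_Icc (hYm x).aemeasurable (Eventually.of_forall fun ω => ?_)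
      rw [mem_Icc, ← abs_le]
      simp only [Y]
      split_ifs
      · simpa using hGB _
      · simpa using hB0.le
    have hindY : iIndepFun (fun x ω => Y x ω - ∫ ω', Y x ω' ∂μ) μ := by
      have h1 := (hind.precomp (rep_injective (d := d) (n := n))).comp
        (fun x y => (if y = a then 1 else 0) * G (pos x) - ∫ ω', Y x ω' ∂μ) fun x =>
          ((Measurable.ite (measurableSet_singleton a) measurable_const
            measurable_const).mul_const _).sub_const _
      exact h1
    have h := HasSubgaussianMGF.measure_sum_ge_le_of_iIndepFun hindY (s := Finset.univ)
      (fun x _ => hsubG x) (ε := δ * (n : ℝ) ^ d) (by positivity)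
    have hset : s k ⊆ {ω | δ * (n : ℝ) ^ d ≤ ∑ x, (Y x ω - ∫ ω', Y x ω' ∂μ)} := by
      intro ω hω
      have h1 : δ ≤ mean fun x : Lattice d n =>
        ((if α (rep x) ω = a then 1 else 0) - p) * G (pos x) := hω
      unfold mean at h1
      rw [one_div, inv_pow, inv_mul_eq_div, le_div_iff₀ hn0] at h1
      refine h1.trans (le_of_eq (Finset.sum_congr rfl fun x _ => ?_))
      rw [hYint]
      simp only [Y]
      ring
    have hexp : Real.exp (-(δ * (n : ℝ) ^ d) ^ 2 /
        (2 * ∑ _x : Lattice d n, ((‖B - (-B)‖₊ / 2) ^ 2 : ℝ≥0))) ≤ Real.exp (-c) ^ k := by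
      rw [← Real.exp_nat_mul, Real.exp_le_exp]
      have h1 : ((∑ _x : Lattice d n, ((‖B - (-B)‖₊ / 2) ^ 2 : ℝ≥0) : ℝ≥0) : ℝ) =
          (n : ℝ) ^ d * B ^ 2 := by
        have h2 : ‖B - -B‖ = 2 * B := by
          rw [Real.norm_eq_abs, sub_neg_eq_add, abs_of_pos (by positivity)]; ring
        rw [Finset.sum_const, Finset.card_univ, card_lattice]
        push_cast [nsmul_eq_mul]
        rw [h2]
        ring
      -- Here $d\ge1$ enters: the number of sites must grow.
      have h2 : (k : ℝ) ≤ (n : ℝ) ^ d := by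
        have h3 : n ≤ n ^ d := Nat.le_self_pow (by omega) n
        have h4 : k ≤ n ^ d := le_trans (by omega) h3
        exact_mod_cast h4
      have h3 : -(δ * (n : ℝ) ^ d) ^ 2 / (2 * ((n : ℝ) ^ d * B ^ 2)) = -((n : ℝ) ^ d * c) := by
        rw [hc]
        field_simp
      rw [h1, h3]
      nlinarith
    calc μ (s k) ≤ μ {ω | δ * (n : ℝ) ^ d ≤ ∑ x, (Y x ω - ∫ ω', Y x ω' ∂μ)} := measure_mono hset
      _ = ENNReal.ofReal (μ.real {ω | δ * (n : ℝ) ^ d ≤ ∑ x, (Y x ω - ∫ ω', Y x ω' ∂μ)}) :=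
          (ofReal_measureReal).symm
      _ ≤ _ := ENNReal.ofReal_le_ofReal (h.trans hexp)
  have hsum : ∑' k, μ (s k) ≠ ∞ := by
    refine ne_top_of_le_ne_top ?_ (ENNReal.tsum_le_tsum hs)
    rw [← ENNReal.ofReal_tsum_of_nonneg (fun k => by positivity)
      (summable_geometric_of_lt_one (Real.exp_pos _).le (by simpa using hc0))]
    exact ENNReal.ofReal_ne_top
  filter_upwards [ae_eventually_notMem hsum] with ω hω
  filter_upwards [hω] with k hk
  exact not_le.1 hk

/-- A countable dense set of test functions and rational-type tolerances give one null set; the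
uniform Lipschitz bound then covers all $G$. The fluctuation of the field and the Riemann sum error
are treated separately. -/
theorem ae_tendsto_fieldError (hd : 1 ≤ d) (hα : ∀ x, Measurable (α x)) (hind : iIndepFun α μ)
    {a p : ℝ} (hp : 0 ≤ p) (hp1 : p ≤ 1) (hlaw : ∀ x, μ {ω | α x ω = a} = ENNReal.ofReal p) :
    ∀ᵐ ω ∂μ, ∀ G : C(Torus d, ℝ),
      Tendsto (fun k => fieldError (fun x => α x ω) a p k G) atTop (𝓝 0) := by
  have h1 : ∀ᵐ ω ∂μ, ∀ j l : ℕ, ∀ᶠ k : ℕ in atTop, |mean fun x : Lattice d (2 * k + 1) =>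
      ((if α (rep x) ω = a then 1 else 0) - p) * TopologicalSpace.denseSeq C(Torus d, ℝ) j (pos x)|
        < 1 / ((l : ℝ) + 1) := by
    rw [ae_all_iff]
    intro j
    rw [ae_all_iff]
    intro l
    set G := TopologicalSpace.denseSeq C(Torus d, ℝ) j
    filter_upwards [ae_eventually_mean_lt hd hα hind hp hlaw G (δ := 1 / ((l : ℝ) + 1))
      (by positivity), ae_eventually_mean_lt hd hα hind hp hlaw (-G) (δ := 1 / ((l : ℝ) + 1))
      (by positivity)] with ω hω hω'
    filter_upwards [hω, hω'] with k hk hk'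
    rw [abs_lt]
    refine ⟨?_, hk⟩
    have e : (mean fun x : Lattice d (2 * k + 1) =>
        ((if α (rep x) ω = a then 1 else 0) - p) * (-G) (pos x)) =
        -mean fun x : Lattice d (2 * k + 1) =>
          ((if α (rep x) ω = a then 1 else 0) - p) * G (pos x) := by
      rw [← neg_one_mul (mean _), ← mean_const_mul]
      congr 1
      ext x
      simp
    linarith
  filter_upwards [h1] with ω hω
  have h2 : ∀ j, Tendsto (fun k => fieldError (fun x => α x ω) a p k
      (TopologicalSpace.denseSeq C(Torus d, ℝ) j)) atTop (𝓝 0) := by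
    intro j
    set G := TopologicalSpace.denseSeq C(Torus d, ℝ) j
    have h3 : Tendsto (fun k => mean fun x : Lattice d (2 * k + 1) =>
        ((if α (rep x) ω = a then 1 else 0) - p) * G (pos x)) atTop (𝓝 0) := by
      rw [tendsto_zero_iff_abs_tendsto_zero]
      refine Metric.tendsto_atTop'.2 fun ε hε => ?_
      obtain ⟨l, hl⟩ := exists_nat_one_div_lt hε
      obtain ⟨K, hK⟩ := eventually_atTop.1 (hω j l)
      refine ⟨K, fun k hk => ?_⟩
      simp only [Function.comp, dist_zero_right, Real.norm_eq_abs, abs_abs]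
      exact (hK k hk.le).trans hl
    have h4 := h3.add (((tendsto_mean_pos G).sub_const (∫ r, G r)).const_mul p)
    simp only [sub_self, mul_zero, add_zero] at h4
    refine h4.congr fun k => ?_
    simp only [fieldError, sub_mul]
    rw [mean_sub, mean_const_mul]
    ring
  exact fun G => tendsto_zero_of_mem_closure
    (fun k G G' => abs_fieldError_sub_le (fun x => α x ω) a hp hp1 k G G')
    (D := range (TopologicalSpace.denseSeq C(Torus d, ℝ))) (forall_mem_range.2 h2)
    (TopologicalSpace.denseRange_denseSeq C(Torus d, ℝ) G)

theorem ae_forall_mem_range {a p : Fin N → ℝ} (ha : Function.Injective a) (hp : ∀ i, 0 ≤ p i)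
    (hp_sum : ∑ i, p i = 1) (hα : ∀ x, Measurable (α x))
    (hlaw : ∀ x i, μ {ω | α x ω = a i} = ENNReal.ofReal (p i)) :
    ∀ᵐ ω ∂μ, ∀ x, α x ω ∈ range a := by
  rw [ae_all_iff]
  intro x
  have h1 : {ω | α x ω ∈ range a} = ⋃ i, {ω | α x ω = a i} := by
    ext ω
    simp [eq_comm]
  have h2 : μ {ω | α x ω ∈ range a} = 1 := by
    have hm : ∀ i, MeasurableSet {ω | α x ω = a i} := fun i => hα x (measurableSet_singleton (a i))
    have hdisj : Pairwise fun i j => Disjoint {ω | α x ω = a i} {ω | α x ω = a j} :=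
      fun i j hij => Set.disjoint_left.2 fun ω (hi : α x ω = a i) (hj : α x ω = a j) =>
        hij (ha (hi.symm.trans hj))
    rw [h1, measure_iUnion hdisj hm, tsum_fintype]
    simp only [hlaw]
    rw [← ENNReal.ofReal_sum_of_nonneg fun i _ => hp i, hp_sum, ENNReal.ofReal_one]
  have h3 : MeasurableSet {ω | α x ω ∈ range a} := hα x (finite_range a).measurableSet
  exact (prob_compl_eq_zero_iff h3).2 h2

end

section

variable {d N : ℕ}

/-! ### Comparison of a path with the solution of the limiting equation -/

/-- The function `tanh (J * m + a θ)`. -/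
def tanhField (J : C(Torus d, ℝ)) (θ a : ℝ) (m : C(Torus d, ℝ)) : C(Torus d, ℝ) :=
  ⟨fun r => Real.tanh (conv J m r + a * θ),
    continuous_tanh.comp ((continuous_conv J m).add continuous_const)⟩

theorem continuous_tanhField (J : C(Torus d, ℝ)) (θ a : ℝ) : Continuous (tanhField J θ a) := by
  have h : LipschitzWith ‖J‖₊ (tanhField J θ a) := LipschitzWith.of_dist_le_mul fun m m' => by
    rw [dist_eq_norm, dist_eq_norm]
    refine (ContinuousMap.norm_le _ (by positivity)).2 fun r => ?_
    refine (abs_tanh_sub_tanh_le _ _).trans ?_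
    rw [add_sub_add_right_eq_sub]
    exact abs_conv_sub_le J m m' r
  exact h.continuous

/-- The difference of `⟨π(σ), G⟩` and `⟨m λ, G⟩`. -/
def avgError {n : ℕ} [NeZero n] (σ : Config d n) (m G : C(Torus d, ℝ)) : ℝ :=
  avg σ G - ∫ r, m r * G r

theorem abs_avgError_le {n : ℕ} [NeZero n] (σ : Config d n) {m : C(Torus d, ℝ)} (hm : ‖m‖ ≤ 1)
    (G : C(Torus d, ℝ)) : |avgError σ m G| ≤ 2 * ‖G‖ := by
  have h1 := abs_avg_le σ G.norm_coe_le_norm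
  have h2 := abs_integral_mul_le (f := m) (B := 1)
    (Eventually.of_forall fun r => (m.norm_coe_le_norm r).trans hm) G.norm_coe_le_norm
  have h3 := abs_sub (avg σ G) (∫ r, m r * G r)
  unfold avgError
  linarith

theorem avgError_smul {n : ℕ} [NeZero n] (σ : Config d n) (m G : C(Torus d, ℝ)) (c : ℝ) :
    avgError σ m (c • G) = c * avgError σ m G := by
  simp only [avgError, avg_eq_mean, ContinuousMap.smul_apply, smul_eq_mul, mul_left_comm _ c,
    mean_const_mul, integral_const_mul, mul_sub]

theorem avgError_sub {n : ℕ} [NeZero n] (σ : Config d n) (m G G' : C(Torus d, ℝ)) :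
    avgError σ m (G - G') = avgError σ m G - avgError σ m G' := by
  have h := avg_sub σ G G'
  unfold avgError
  simp only [ContinuousMap.coe_sub, ContinuousMap.sub_apply, mul_sub]
  rw [integral_sub (integrable_of_continuous (by fun_prop)) (integrable_of_continuous (by fun_prop))]
  have e : avg σ (⇑G - ⇑G') = avg σ G - avg σ G' := h
  rw [e]
  ring

/-- As $\alpha$ takes values among the distinct $a_i$, the indicators select the right $\tanh$ at
each site. This turns the law of large numbers for level sets into one for the nonlinear drift. -/
theorem sum_fieldError_eq {J : C(Torus d, ℝ)} {θ : ℝ} {a p : Fin N → ℝ}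
    (ha : Function.Injective a) {α : (Fin d → ℤ) → ℝ} (hα : ∀ x, α x ∈ range a) (k : ℕ)
    (m G : C(Torus d, ℝ)) :
    ∑ i, fieldError α (a i) (p i) k (tanhField J θ (a i) m * G) =
      (mean fun x : Lattice d (2 * k + 1) =>
        Real.tanh (conv J m (pos x) + α (rep x) * θ) * G (pos x)) -
      ∫ r, drift J θ a p m r * G r := by
  have h1 : ∫ r, drift J θ a p m r * G r = ∑ i, p i * ∫ r, (tanhField J θ (a i) m * G) r := by
    simp only [← integral_const_mul]
    rw [← integral_finsetSum _ fun i _ => integrable_of_continuous (by fun_prop)]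
    refine integral_congr_ae (Eventually.of_forall fun r => ?_)
    simp only [drift_apply, Finset.sum_mul, ContinuousMap.mul_apply, mul_assoc]
    rfl
  simp only [fieldError]
  rw [Finset.sum_sub_distrib, ← h1, ← mean_sum]
  congr 2
  ext x
  obtain ⟨j, hj⟩ := hα (rep x)
  rw [← hj]
  simp only [ha.eq_iff, ite_mul, one_mul, zero_mul, Finset.sum_ite_eq, Finset.mem_univ, if_true]
  rfl

/-- Three errors occur: the empirical measure in place of $m$ inside $\tanh$ (at most `K`), the
self-interaction, and the fluctuation of the field (at most `ε` each). The linear term gives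
`avgError` itself. -/
theorem abs_drift_error_le {J : C(Torus d, ℝ)} (hJ : ∀ r, J (-r) = J r) {θ : ℝ} {a p : Fin N → ℝ}
    (ha : Function.Injective a) {α : (Fin d → ℤ) → ℝ} (hα : ∀ x, α x ∈ range a) {k : ℕ}
    (σ : Config d (2 * k + 1)) (m G : C(Torus d, ℝ)) {K ε : ℝ}
    (hfield : |∑ i, fieldError α (a i) (p i) k (tanhField J θ (a i) m * G)| ≤ ε)
    (hJn : (1 / ((2 * k + 1 : ℕ) : ℝ)) ^ d * ‖J‖ ≤ ε)
    (hK : ∀ r, |avgError σ m (shift J r)| ≤ K) :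
    |generator J θ α (fun τ => avg τ G) σ - ∫ r, (-m r + drift J θ a p m r) * G r| ≤
      |avgError σ m G| + (K + ε) * ‖G‖ + ε := by
  have hsplit : (∫ r, (-m r + drift J θ a p m r) * G r) =
      -(∫ r, m r * G r) + ∫ r, drift J θ a p m r * G r := by
    rw [← integral_neg, ← integral_add (integrable_of_continuous (by fun_prop))
      (integrable_of_continuous (by fun_prop))]
    refine integral_congr_ae (Eventually.of_forall fun r => ?_)
    simp only
    ring
  have hdiff : |(mean fun x => Real.tanh (localField J θ α σ x) * G (pos x)) -
      mean fun x : Lattice d (2 * k + 1) =>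
        Real.tanh (conv J m (pos x) + α (rep x) * θ) * G (pos x)| ≤ (K + ε) * ‖G‖ := by
    rw [← mean_sub]
    refine abs_mean_le fun x => ?_
    rw [← sub_mul, abs_mul]
    have h1 : |localField J θ α σ x - (conv J m (pos x) + α (rep x) * θ)| ≤ K + ε := by
      have e : localField J θ α σ x - (conv J m (pos x) + α (rep x) * θ) =
          avgError σ m (shift J (pos x)) - (1 / ((2 * k + 1 : ℕ) : ℝ)) ^ d * J 0 * spin σ x := by
        rw [conv_eq]
        unfold localField avgError
        have e' : avg σ (shift J (pos x)) = avg σ fun r => J (pos x - r) := rfl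
        rw [e']
        ring
      rw [e]
      have h2 : |(1 / ((2 * k + 1 : ℕ) : ℝ)) ^ d * J 0 * spin σ x| ≤ ε := by
        rw [abs_mul, abs_spin, mul_one, abs_mul, abs_of_nonneg (by positivity)]
        refine le_trans ?_ hJn
        gcongr
        exact J.norm_coe_le_norm 0
      exact (abs_sub _ _).trans (add_le_add (hK _) h2)
    have h2 := (abs_tanh_sub_tanh_le (localField J θ α σ x)
      (conv J m (pos x) + α (rep x) * θ)).trans h1
    exact mul_le_mul h2 (G.norm_coe_le_norm _) (abs_nonneg _) ((abs_nonneg _).trans h2)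
  rw [sum_fieldError_eq ha hα] at hfield
  rw [generator_avg hJ, hsplit]
  unfold avgError
  rw [abs_le] at hdiff hfield ⊢
  have h3 := neg_abs_le (avg σ G - ∫ r, m r * G r)
  have h4 := le_abs_self (avg σ G - ∫ r, m r * G r)
  constructor <;> linarith

/-- A path whose martingale parts are small stays close to the solution of the limiting
equation. -/
theorem abs_avgError_path_le {J : C(Torus d, ℝ)} (hJ : ∀ r, J (-r) = J r) {θ : ℝ}
    {a p : Fin N → ℝ} (ha : Function.Injective a) {α : (Fin d → ℤ) → ℝ} (hα : ∀ x, α x ∈ range a)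
    {u : ℝ → C(Torus d, ℝ)} (hu : ∀ t, HasDerivAt u (-u t + drift J θ a p (u t)) t)
    (hu1 : ∀ t, 0 ≤ t → ‖u t‖ ≤ 1) {S : Set C(Torus d, ℝ)} (hJS : ∀ r, shift J r ∈ S) {R : ℝ}
    (hR0 : 0 ≤ R) (hR : ∀ G ∈ S, ‖G‖ ≤ R) {k : ℕ} (w : Path d (2 * k + 1)) {T : ℝ≥0} {ε : ℝ}
    (hε : 0 ≤ ε) (h0 : ∀ G ∈ S, |avgError (w.at 0) (u 0) G| ≤ ε)
    (hfield : ∀ s ∈ Icc (0 : ℝ) T, ∀ G ∈ S,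
      |∑ i, fieldError α (a i) (p i) k (tanhField J θ (a i) (u s) * G)| ≤ ε)
    (hJn : (1 / ((2 * k + 1 : ℕ) : ℝ)) ^ d * ‖J‖ ≤ ε)
    (hM : ∀ t ≤ T, ∀ G ∈ S, |mart J θ α (fun σ => avg σ G) t w| ≤ ε) {t : ℝ≥0} (ht : t ≤ T)
    {G : C(Torus d, ℝ)} (hG : G ∈ S) :
    |avgError (w.at t) (u t) G| ≤
      2 * (ε * (2 + (R + 1) * T)) * Real.exp (2 * (1 + R) * T) := by
  have hT0 : (0 : ℝ) ≤ T := T.coe_nonneg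
  have hcu : Continuous u := continuous_iff_continuousAt.2 fun t => (hu t).continuousAt
  -- The constant error collects `ε` from the initial condition, `ε` from the martingale and
  -- $(R+1)\varepsilon$ per unit time from the drift.
  have key := abs_le_of_forall_abs_le_exp (ι := S) (T := T) (C := 1 + R)
    (z := fun s G => avgError (w.at s.toNNReal) (u s) G.1) (ε := ε * (2 + (R + 1) * T))
    (B := 2 * R) (by positivity) (by positivity) ?_ ?_ (t := t) ⟨t.coe_nonneg, ht⟩ ⟨G, hG⟩
  · simpa using key
  · rintro s hs ⟨G, hG⟩
    exact (abs_avgError_le _ (hu1 s hs.1) G).trans (by linarith [hR G hG])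
  · rintro K hK0 hK s hs ⟨G, hG⟩
    have hw : IntervalIntegrable (fun v : ℝ => generator J θ α (fun σ => avg σ G)
        (w.at v.toNNReal)) volume 0 s := intervalIntegrable_at _ w _ _
    have hcont : Continuous fun v => ∫ r, (-u v r + drift J θ a p (u v) r) * G r := by
      have hd : Continuous fun v => drift J θ a p (u v) := by
        have : ∀ m, drift J θ a p m = ∑ i, p i • tanhField J θ (a i) m := fun m => by
          ext r
          simp [drift_apply, tanhField]
        simp only [this]
        have := continuous_tanhField J θ
        fun_prop
      obtain ⟨D, hD⟩ : ∃ D : ℝ → C(Torus d, ℝ), ∀ v, drift J θ a p (u v) = D v :=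
        ⟨_, fun _ => rfl⟩
      simp only [hD] at hd ⊢
      have h := continuous_parametric_integral_of_continuous
        (μ := (volume : Measure (Torus d)))
        (f := fun v r => (-u v r + D v r) * G r) (by fun_prop) isCompact_univ
      simpa only [Measure.restrict_univ] using h
    have hu_eq : ∫ r, u s r * G r = (∫ r, u 0 r * G r) +
        ∫ v in (0 : ℝ)..s, ∫ r, (-u v r + drift J θ a p (u v) r) * G r := by
      have h := (isWeakSolution_of_hasDerivAt (m₀ := u 0) rfl hu).equation (fun _ r => G r)
        (fun _ _ => 0) (by fun_prop) (by fun_prop) (fun s r => hasDerivAt_const s (G r)) s hs.1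
      simp only [mul_zero, integral_zero, intervalIntegral.integral_zero, sub_zero] at h
      simp only [drift_apply]
      linarith
    have hmart : mart J θ α (fun σ => avg σ G) s.toNNReal w = avg (w.at s.toNNReal) G -
        avg (w.at 0) G - ∫ v in (0 : ℝ)..s, generator J θ α (fun σ => avg σ G)
          (w.at v.toNNReal) := by
      unfold mart
      rw [Real.coe_toNNReal s hs.1]
    have e : avgError (w.at s.toNNReal) (u s) G = avgError (w.at 0) (u 0) G +
        mart J θ α (fun σ => avg σ G) s.toNNReal w +
        ∫ v in (0 : ℝ)..s, (generator J θ α (fun σ => avg σ G) (w.at v.toNNReal) -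
          ∫ r, (-u v r + drift J θ a p (u v) r) * G r) := by
      rw [intervalIntegral.integral_sub hw (hcont.intervalIntegrable _ _), hmart]
      unfold avgError
      rw [hu_eq]
      ring
    have hint : |∫ v in (0 : ℝ)..s, (generator J θ α (fun σ => avg σ G) (w.at v.toNNReal) -
        ∫ r, (-u v r + drift J θ a p (u v) r) * G r)| ≤
        ∫ v in (0 : ℝ)..s, ((1 + R) * K * Real.exp (2 * (1 + R) * v) + (R + 1) * ε) := by
      rw [← Real.norm_eq_abs]
      refine intervalIntegral.norm_integral_le_of_norm_le hs.1
        (Eventually.of_forall fun v hv => ?_) (Continuous.intervalIntegrable (by fun_prop) _ _)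
      have hv' : v ∈ Icc (0 : ℝ) T := ⟨hv.1.le, hv.2.trans hs.2⟩
      have h1 := abs_drift_error_le hJ ha hα (w.at v.toNNReal) (u v) G (hfield v hv' G hG) hJn
        fun r => hK v hv' ⟨shift J r, hJS r⟩
      have h2 := hK v hv' ⟨G, hG⟩
      have h3 : (K * Real.exp (2 * (1 + R) * v) + ε) * ‖G‖ ≤
          (K * Real.exp (2 * (1 + R) * v) + ε) * R := by
        gcongr
        exact hR G hG
      rw [Real.norm_eq_abs]
      simp only at h2
      linarith
    rw [intervalIntegral.integral_add (Continuous.intervalIntegrable (by fun_prop) _ _)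
      intervalIntegrable_const, intervalIntegral.integral_const, sub_zero, smul_eq_mul] at hint
    have h1 := h0 G hG
    have h2 := hM s.toNNReal (Real.toNNReal_le_iff_le_coe.2 hs.2) G hG
    have h3 : s * ((R + 1) * ε) ≤ T * ((R + 1) * ε) := by
      gcongr
      exact hs.2
    simp only
    rw [e]
    refine (abs_add_three _ _ _).trans ?_
    linarith

/-! ### Convergence in probability -/

theorem mart_avg_sub {n : ℕ} [NeZero n] (J : Torus d → ℝ) (θ : ℝ) (α : (Fin d → ℤ) → ℝ)
    (G G' : C(Torus d, ℝ)) (t : ℝ≥0) (w : Path d n) :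
    mart J θ α (fun σ => avg σ (G - G')) t w =
      mart J θ α (fun σ => avg σ G) t w - mart J θ α (fun σ => avg σ G') t w := by
  have h1 : ∀ σ : Config d n, avg σ (⇑G - ⇑G') = avg σ G - avg σ G' := fun σ => avg_sub σ G G'
  have h2 : ∀ σ : Config d n, generator J θ α (fun σ => avg σ G - avg σ G') σ =
      generator J θ α (fun σ => avg σ G) σ - generator J θ α (fun σ => avg σ G') σ := fun σ => by
    unfold generator
    rw [← Finset.sum_sub_distrib]
    exact Finset.sum_congr rfl fun x _ => by ring
  simp only [mart, h1, h2]
  rw [intervalIntegral.integral_sub (intervalIntegrable_at _ w _ _) (intervalIntegrable_at _ w _ _)]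
  ring

theorem abs_mart_avg_le {n : ℕ} [NeZero n] {J : Torus d → ℝ} (hJ : ∀ r, J (-r) = J r) {θ : ℝ}
    {α : (Fin d → ℤ) → ℝ} (G : C(Torus d, ℝ)) (t : ℝ≥0) (w : Path d n) :
    |mart J θ α (fun σ => avg σ G) t w| ≤ (2 + 2 * t) * ‖G‖ := by
  have h1 := abs_le.1 (abs_avg_le (w.at t) G.norm_coe_le_norm)
  have h2 := abs_le.1 (abs_avg_le (w.at 0) G.norm_coe_le_norm)
  have h3 := abs_le.1 (abs_integral_at_le (g := generator J θ α fun σ => avg σ G)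
    (abs_generator_avg_le hJ G.norm_coe_le_norm) w t)
  rw [abs_le]
  unfold mart
  constructor <;> linarith

theorem tendsto_one_div_pow (hd : 1 ≤ d) :
    Tendsto (fun k : ℕ => (1 / ((2 * k + 1 : ℕ) : ℝ)) ^ d) atTop (𝓝 0) := by
  have h1 : Tendsto (fun k : ℕ => 1 / ((2 * k + 1 : ℕ) : ℝ)) atTop (𝓝 0) :=
    tendsto_one_div_atTop_nhds_zero_nat.comp
      (tendsto_atTop_mono (fun k => by omega : ∀ k : ℕ, k ≤ 2 * k + 1) tendsto_id)
  simpa [zero_pow (by omega : d ≠ 0)] using h1.pow d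

/-- Convergence in probability, uniformly in time and over a compact set of test functions. -/
theorem tendsto_measure_exists_le_avgError (hd : 1 ≤ d) {J : C(Torus d, ℝ)}
    (hJ : ∀ r, J (-r) = J r) {θ : ℝ} {a p : Fin N → ℝ} (ha : Function.Injective a)
    (hp : ∀ i, 0 ≤ p i) (hp1 : ∀ i, p i ≤ 1)
    {α : (Fin d → ℤ) → ℝ} (hα : ∀ x, α x ∈ range a)
    (hfield : ∀ i, ∀ G : C(Torus d, ℝ),
      Tendsto (fun k => fieldError α (a i) (p i) k G) atTop (𝓝 0))
    {u : ℝ → C(Torus d, ℝ)} (hu : ∀ t, HasDerivAt u (-u t + drift J θ a p (u t)) t)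
    (hu1 : ∀ t, 0 ≤ t → ‖u t‖ ≤ 1) {η : ∀ k : ℕ, Config d (2 * k + 1)}
    (hη : ∀ G : C(Torus d, ℝ), Tendsto (fun k => avgError (η k) (u 0) G) atTop (𝓝 0))
    {P : ∀ k : ℕ, Measure (Path d (2 * k + 1))} (hP : ∀ k, IsGlauberLaw J θ α (η k) (P k))
    {S : Set C(Torus d, ℝ)} (hS : IsCompact S) (T : ℝ≥0) {δ : ℝ} (hδ : 0 < δ) :
    Tendsto (fun k => P k {w | ∃ t ≤ T, ∃ G ∈ S, δ ≤ |avgError (w.at t) (u t) G|})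
      atTop (𝓝 0) := by
  have hcu : Continuous u := continuous_iff_continuousAt.2 fun t => (hu t).continuousAt
  -- The shifts of $J$ must be among the test functions for the Grönwall estimate to close; their
  -- range is compact.
  set S' : Set C(Torus d, ℝ) := S ∪ range (shift J) with hS'
  have hS'c : IsCompact S' := hS.union (isCompact_range (shift J).continuous)
  obtain ⟨R, hR0, hR⟩ : ∃ R : ℝ, 0 ≤ R ∧ ∀ G ∈ S', ‖G‖ ≤ R := by
    obtain ⟨R, hR⟩ := hS'c.isBounded.exists_norm_le
    exact ⟨|R|, abs_nonneg R, fun G hG => (hR G hG).trans (le_abs_self R)⟩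
  set E : ℝ := 2 * (2 + (R + 1) * T) * Real.exp (2 * (1 + R) * T) with hE
  have hE0 : 0 < E := by positivity
  set ε : ℝ := δ / (2 * E) with hεdef
  have hε : 0 < ε := by positivity
  have hεδ : 2 * (ε * (2 + (R + 1) * T)) * Real.exp (2 * (1 + R) * T) < δ := by
    have e : 2 * (ε * (2 + (R + 1) * T)) * Real.exp (2 * (1 + R) * T) = ε * E := by
      rw [hE]; ring
    have e2 : ε * E = δ / 2 := by rw [hεdef]; field_simp
    rw [e, e2]
    exact half_lt_self hδ
  -- Martingales of functions at this distance differ by less than $\varepsilon/2$ up to time `T`,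
  -- so Doob's inequality is needed only on a finite net that does not depend on `k`.
  obtain ⟨F, hFS, hF, hcov⟩ := hS'c.finite_cover_balls (e := ε / (2 * (2 + 2 * T)))
    (by positivity)
  have h0 : ∀ᶠ k in atTop, ∀ G ∈ S', |avgError (η k) (u 0) G| < ε := by
    refine eventually_forall_abs_lt_of_isCompact (C := 2) (fun k G G' => ?_) hη hS'c hε
    rw [← avgError_sub, dist_eq_norm]
    exact abs_avgError_le _ (hu1 0 le_rfl) _
  have hf : ∀ᶠ k in atTop, ∀ s ∈ Icc (0 : ℝ) T, ∀ G ∈ S',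
      |∑ i, fieldError α (a i) (p i) k (tanhField J θ (a i) (u s) * G)| ≤ ε := by
    have h1 : ∀ i, ∀ᶠ k in atTop, ∀ W ∈ (fun q : ℝ × C(Torus d, ℝ) =>
        tanhField J θ (a i) (u q.1) * q.2) '' (Icc (0 : ℝ) T ×ˢ S'),
        |fieldError α (a i) (p i) k W| < ε / (N + 1) := fun i => by
      refine eventually_forall_abs_lt_of_isCompact (C := 2)
        (fun k G G' => abs_fieldError_sub_le α (a i) (hp i) (hp1 i) k G G') (hfield i)
        ((isCompact_Icc.prod hS'c).image ?_) (by positivity)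
      exact (((continuous_tanhField J θ (a i)).comp (hcu.comp continuous_fst))).mul continuous_snd
    filter_upwards [eventually_all.2 h1] with k hk s hs G hG
    calc |∑ i, fieldError α (a i) (p i) k (tanhField J θ (a i) (u s) * G)|
        ≤ ∑ i, |fieldError α (a i) (p i) k (tanhField J θ (a i) (u s) * G)| :=
          Finset.abs_sum_le_sum_abs _ _
      _ ≤ ∑ _i : Fin N, ε / (N + 1) := Finset.sum_le_sum fun i _ =>
          (hk i _ ⟨(s, G), ⟨hs, hG⟩, rfl⟩).le
      _ = N * (ε / (N + 1)) := by simp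
      _ ≤ ε := by
          rw [mul_div_assoc', div_le_iff₀ (by positivity)]
          nlinarith
  have hJn : ∀ᶠ k : ℕ in atTop, (1 / ((2 * k + 1 : ℕ) : ℝ)) ^ d * ‖J‖ < ε := by
    have h := (tendsto_one_div_pow hd).mul_const ‖J‖
    rw [zero_mul] at h
    exact h.eventually_lt_const hε
  have hbound : ∀ᶠ k in atTop, P k {w | ∃ t ≤ T, ∃ G ∈ S, δ ≤ |avgError (w.at t) (u t) G|} ≤
      ∑ _g ∈ hF.toFinset, ENNReal.ofReal
        (4 * R ^ 2 * (1 / ((2 * k + 1 : ℕ) : ℝ)) ^ d * T / (ε / 2) ^ 2) := by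
    filter_upwards [h0, hf, hJn] with k hk0 hkf hkJ
    -- An inclusion suffices: outer measure is monotone, so the uncountable quantifiers raise no
    -- measurability question.
    have hsub : {w | ∃ t ≤ T, ∃ G ∈ S, δ ≤ |avgError (w.at t) (u t) G|} ⊆
        {w : Path d (2 * k + 1) | w.at 0 ≠ η k} ∪ ⋃ g ∈ hF.toFinset,
          {w | ∃ t ≤ T, ε / 2 < |mart J θ α (fun σ => avg σ g) t w|} := by
      rintro w ⟨t, ht, G, hG, hw⟩
      by_contra hcon
      simp only [mem_union, mem_ofPred_eq, mem_iUnion, not_or, not_exists, not_not, not_and,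
        not_lt, Finite.mem_toFinset] at hcon
      obtain ⟨hw0, hwM⟩ := hcon
      refine absurd (abs_avgError_path_le hJ ha hα hu hu1 (S := S') (fun r => Or.inr ⟨r, rfl⟩) hR0
        hR w hε.le (by rw [hw0]; exact fun G hG => (hk0 G hG).le) hkf hkJ.le ?_ ht
        (Or.inl hG)) (not_le.2 (hεδ.trans_le hw))
      intro s hs G' hG'
      obtain ⟨g, hg, hgG⟩ := mem_iUnion₂.1 (hcov hG')
      have h1 := hwM g hg s hs
      have h2 := abs_mart_avg_le hJ (θ := θ) (α := α) (G' - g) s w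
      have h3 := mart_avg_sub J θ α G' g s w
      have h4 : (2 + 2 * (s : ℝ)) * ‖G' - g‖ ≤ (2 + 2 * T) * (ε / (2 * (2 + 2 * T))) := by
        rw [← dist_eq_norm]
        gcongr
        exact (Metric.mem_ball.1 hgG).le
      have h5 : (2 + 2 * (T : ℝ)) * (ε / (2 * (2 + 2 * T))) = ε / 2 := by field_simp
      have h6 : mart J θ α (fun σ => avg σ G') s w =
          mart J θ α (fun σ => avg σ (G' - g)) s w + mart J θ α (fun σ => avg σ g) s w := by
        rw [h3]; ring
      rw [h6]
      refine (abs_add_le _ _).trans ?_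
      have h7 : |mart J θ α (fun σ => avg σ (⇑G' - ⇑g)) s w| ≤ (2 + 2 * (s : ℝ)) * ‖G' - g‖ := h2
      linarith
    refine (measure_mono hsub).trans ((measure_union_le _ _).trans ?_)
    have hinit : P k {w | w.at 0 ≠ η k} = 0 := (hP k).initial
    rw [hinit, zero_add]
    refine (measure_biUnion_finset_le _ _).trans (Finset.sum_le_sum fun g hg => ?_)
    have hgR : ∀ r, |g r| ≤ R := fun r =>
      (g.norm_coe_le_norm r).trans (hR g (hFS ((Finite.mem_toFinset hF).1 hg)))
    have hC : ∀ σ : Config d (2 * k + 1), ∑ x, rate J θ α x σ *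
        (avg (flip σ x) g - avg σ g) ^ 2 ≤ 4 * R ^ 2 * (1 / ((2 * k + 1 : ℕ) : ℝ)) ^ d :=
      fun σ => sum_rate_mul_sq_avg_le hJ hgR σ
    exact IsGlauberLaw.measure_exists_lt_mart_le (hP k) (f := fun σ => avg σ g) hC T (half_pos hε)
  refine tendsto_of_tendsto_of_tendsto_of_le_of_le' tendsto_const_nhds ?_
    (Eventually.of_forall fun k => zero_le) hbound
  have h1 : Tendsto (fun k : ℕ => ENNReal.ofReal
      (4 * R ^ 2 * (1 / ((2 * k + 1 : ℕ) : ℝ)) ^ d * T / (ε / 2) ^ 2)) atTop (𝓝 0) := by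
    rw [← ENNReal.ofReal_zero]
    refine ENNReal.tendsto_ofReal ?_
    have h := (((tendsto_one_div_pow hd).const_mul (4 * R ^ 2)).mul_const (T : ℝ)).div_const
      ((ε / 2) ^ 2)
    simpa using h
  simpa using tendsto_finsetSum hF.toFinset fun g _ => h1

/-! ### The distance on measures -/

theorem rho_eq {n : ℕ} [NeZero n] (H : ℕ → C(Torus d, ℝ)) (σ : Config d n) (m : C(Torus d, ℝ)) :
    rho H (empirical σ) (density m) = ∑' k : ℕ, (1 / 2 : ℝ) ^ k * |avgError σ m (H k)| := by
  unfold rho avgError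
  simp only [pairing_sub σ (integrable_of_continuous m.continuous)]

theorem summable_rho {n : ℕ} [NeZero n] {H : ℕ → C(Torus d, ℝ)} (hH : ∀ k, ‖H k‖ ≤ 1)
    (σ : Config d n) {m : C(Torus d, ℝ)} (hm : ‖m‖ ≤ 1) :
    Summable fun k : ℕ => (1 / 2 : ℝ) ^ k * |avgError σ m (H k)| := by
  refine Summable.of_nonneg_of_le (fun k => by positivity) (fun k => ?_)
    ((summable_geometric_of_lt_one (by norm_num : (0 : ℝ) ≤ 1 / 2) (by norm_num)).mul_right 2)
  gcongr
  exact (abs_avgError_le σ hm _).trans (by linarith [hH k])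

/-- Each term of the series is at most `rho`, which settles the `H j`; density gives the unit ball
and scaling gives every $G$. -/
theorem tendsto_avgError_of_tendsto_rho {H : ℕ → C(Torus d, ℝ)} (hH : IsDenseInUnitBall H)
    {m : C(Torus d, ℝ)} (hm : ‖m‖ ≤ 1) {η : ∀ k : ℕ, Config d (2 * k + 1)}
    (hη : Tendsto (fun k => rho H (empirical (η k)) (density m)) atTop (𝓝 0))
    (G : C(Torus d, ℝ)) : Tendsto (fun k => avgError (η k) m G) atTop (𝓝 0) := by
  have h1 : ∀ j, Tendsto (fun k => avgError (η k) m (H j)) atTop (𝓝 0) := fun j => by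
    rw [tendsto_zero_iff_abs_tendsto_zero]
    have h2 := hη.const_mul ((2 : ℝ) ^ j)
    rw [mul_zero] at h2
    refine squeeze_zero (fun k => abs_nonneg _) (fun k => ?_) h2
    have h3 := (summable_rho hH.1 (η k) hm).le_tsum j fun i _ => by positivity
    rw [← rho_eq] at h3
    calc |avgError (η k) m (H j)| = 2 ^ j * ((1 / 2 : ℝ) ^ j * |avgError (η k) m (H j)|) := by
          rw [← mul_assoc, ← mul_pow]; norm_num
      _ ≤ 2 ^ j * rho H (empirical (η k)) (density m) := by gcongr
  have h2 : ∀ G : C(Torus d, ℝ), ‖G‖ ≤ 1 →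
      Tendsto (fun k => avgError (η k) m G) atTop (𝓝 0) := fun G hG =>
    tendsto_zero_of_mem_closure (C := 2) (fun k G G' => by
      rw [← avgError_sub, dist_eq_norm]
      exact abs_avgError_le _ hm _) (forall_mem_range.2 h1) (hH.2 (by simpa using hG))
  have hc : 0 < ‖G‖ + 1 := by positivity
  have h3 := (h2 ((‖G‖ + 1)⁻¹ • G) (by
    rw [norm_smul, norm_inv, Real.norm_eq_abs, abs_of_pos hc, inv_mul_le_iff₀ hc]
    linarith)).const_mul (‖G‖ + 1)
  rw [mul_zero] at h3
  refine h3.congr fun k => ?_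
  rw [avgError_smul, mul_inv_cancel_left₀ hc.ne']

/-- Writing $2^{-k}=(2/3)^k(3/4)^k$, the factor $(3/4)^k$ makes the test functions tend to zero,
hence compact together with $0$, while $\sum(2/3)^k=3$ leaves $3\delta/4<\delta$. -/
theorem rho_lt_of_forall_lt {n : ℕ} [NeZero n] {H : ℕ → C(Torus d, ℝ)} (hH : ∀ k, ‖H k‖ ≤ 1)
    (σ : Config d n) {m : C(Torus d, ℝ)} (hm : ‖m‖ ≤ 1) {δ : ℝ} (hδ : 0 < δ)
    (h : ∀ k, |avgError σ m ((3 / 4 : ℝ) ^ k • H k)| < δ / 4) :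
    rho H (empirical σ) (density m) < δ := by
  have hgeo : Summable fun k : ℕ => (2 / 3 : ℝ) ^ k * (δ / 4) :=
    (summable_geometric_of_lt_one (by norm_num) (by norm_num)).mul_right _
  have hle : ∀ k, (1 / 2 : ℝ) ^ k * |avgError σ m (H k)| ≤ (2 / 3 : ℝ) ^ k * (δ / 4) := fun k => by
    have h1 := (h k).le
    rw [avgError_smul, abs_mul, abs_of_pos (by positivity)] at h1
    calc (1 / 2 : ℝ) ^ k * |avgError σ m (H k)| =
          (2 / 3 : ℝ) ^ k * ((3 / 4 : ℝ) ^ k * |avgError σ m (H k)|) := by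
          rw [← mul_assoc, ← mul_pow]; norm_num
      _ ≤ _ := by gcongr
  rw [rho_eq]
  calc _ ≤ ∑' k : ℕ, (2 / 3 : ℝ) ^ k * (δ / 4) := (summable_rho hH σ hm).tsum_le_tsum hle hgeo
    _ = 3 * (δ / 4) := by
        rw [tsum_mul_right, tsum_geometric_of_lt_one (by norm_num) (by norm_num)]; norm_num
    _ < δ := by linarith

theorem isCompact_insert_range_smul {H : ℕ → C(Torus d, ℝ)} (hH : ∀ k, ‖H k‖ ≤ 1) :
    IsCompact (insert 0 (range fun k => (3 / 4 : ℝ) ^ k • H k)) := by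
  refine Tendsto.isCompact_insert_range ?_
  refine squeeze_zero_norm (fun k => ?_)
    (tendsto_pow_atTop_nhds_zero_of_lt_one (by norm_num : (0 : ℝ) ≤ 3 / 4) (by norm_num))
  rw [norm_smul, norm_pow, Real.norm_eq_abs, abs_of_pos (by norm_num)]
  exact mul_le_of_le_one_right (by positivity) (hH k)

end

end KacGlauber

end

/-! ### Assembly of the theorem. -/

theorem theorem2p2 {d : ℕ} (hd : 1 ≤ d)
    -- the random field: i.i.d., equal to `a i` with probability `p i`
    {N : ℕ} (a p : Fin N → ℝ) (ha : Function.Injective a) (hp : ∀ i, 0 ≤ p i)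
    (hp_sum : ∑ i, p i = 1)
    {Ω : Type*} [MeasurableSpace Ω] (μ : Measure Ω) [IsProbabilityMeasure μ]
    (α : (Fin d → ℤ) → Ω → ℝ) (hα : ∀ x, Measurable (α x)) (hα_indep : iIndepFun α μ)
    (hα_law : ∀ x i, μ {ω | α x ω = a i} = ENNReal.ofReal (p i))
    -- the interaction and the strength of the field
    (J : KacGlauber.Torus d → ℝ) (hJ : KacGlauber.IsC1 J) (hJ_symm : ∀ r, J (-r) = J r)
    (hJ_int : ∫ r, J r = 1) (θ : ℝ) (hθ : 0 < θ)
    -- the distance on measures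
    (H : ℕ → C(KacGlauber.Torus d, ℝ)) (hH : KacGlauber.IsDenseInUnitBall H)
    -- the initial condition, `γ = 1 / (2 k + 1)`
    (m₀ : C(KacGlauber.Torus d, ℝ)) (hm₀ : ∀ r, m₀ r ∈ Icc (-1 : ℝ) 1)
    (η : ∀ k : ℕ, KacGlauber.Config d (2 * k + 1))
    (hη : Tendsto (fun k => KacGlauber.rho H (KacGlauber.empirical (η k)) (KacGlauber.density m₀))
      atTop (𝓝 0))
    -- the law of the dynamics in each realization of the field
    (P : ∀ k : ℕ, Ω → Measure (KacGlauber.Path d (2 * k + 1)))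
    (hP : ∀ k ω, KacGlauber.IsGlauberLaw J θ (fun x => α x ω) (η k) (P k ω)) :
    ∃ m : ℝ → KacGlauber.Torus d → ℝ,
      -- `m` is the unique weak solution, and its values are in `[-1, 1]`
      KacGlauber.IsWeakSolution J θ a p m₀ m ∧
      (∀ m' : ℝ → KacGlauber.Torus d → ℝ, KacGlauber.IsWeakSolution J θ a p m₀ m' →
        ∀ t : ℝ, 0 ≤ t → m' t =ᵐ[volume] m t) ∧
      (∀ t : ℝ, 0 ≤ t → ∀ᵐ r, |m t r| ≤ 1) ∧
      ∀ᵐ ω ∂μ,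
        -- convergence in the weak topology at each time
        (∀ t : ℝ≥0, ∀ δ : ℝ, 0 < δ →
          Tendsto (fun k => P k ω {w | δ ≤
            KacGlauber.rho H (KacGlauber.empirical (w.at t)) (KacGlauber.density (m t))})
            atTop (𝓝 0)) ∧
        -- convergence uniformly in time
        (∀ T : ℝ≥0, 0 < T → ∀ G : ℝ → KacGlauber.Torus d → ℝ,
          ContinuousOn (Function.uncurry G) (Icc (0 : ℝ) T ×ˢ univ) →
          (∀ t ∈ Icc (0 : ℝ) T, KacGlauber.IsC1 (G t)) →
          ∀ δ : ℝ, 0 < δ →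
          Tendsto (fun k => P k ω {w | δ ≤ ⨆ t : Icc (0 : ℝ≥0) T,
            |KacGlauber.pairing (KacGlauber.empirical (w.at t)) (G t) -
              KacGlauber.pairing (KacGlauber.density (m t)) (G t)|})
            atTop (𝓝 0)) := by
  have hJc := hJ.continuous
  obtain ⟨J, rfl⟩ : ∃ J' : C(KacGlauber.Torus d, ℝ), ⇑J' = J := ⟨⟨J, hJc⟩, rfl⟩
  have hm₀' : ‖m₀‖ ≤ 1 := (ContinuousMap.norm_le _ zero_le_one).2 fun r => abs_le.2 (hm₀ r)
  have hp1 : ∀ i, p i ≤ 1 := fun i => by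
    rw [← hp_sum]
    exact Finset.single_le_sum (fun j _ => hp j) (Finset.mem_univ i)
  obtain ⟨u, hu0, hu, hu1⟩ :=
    KacGlauber.exists_global_solution (J := J) (θ := θ) (a := a) hp hp_sum hm₀'
  have hsol := KacGlauber.isWeakSolution_of_hasDerivAt hu0 hu
  refine ⟨fun t r => u t r, hsol, fun m' hm' t ht => hsol.ae_eq hp hp_sum hm' ht, fun t ht =>
    Eventually.of_forall fun r => ((u t).norm_coe_le_norm r).trans (hu1 t ht), ?_⟩
  have hη' : ∀ G : C(KacGlauber.Torus d, ℝ),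
      Tendsto (fun k => KacGlauber.avgError (η k) (u 0) G) atTop (𝓝 0) := by
    rw [hu0]
    exact KacGlauber.tendsto_avgError_of_tendsto_rho hH hm₀' hη
  have hfield := ae_all_iff.2 fun i => KacGlauber.ae_tendsto_fieldError hd hα hα_indep (hp i)
    (hp1 i) fun x => hα_law x i
  filter_upwards [hfield, KacGlauber.ae_forall_mem_range ha hp hp_sum hα hα_law] with ω hω hωa
  have key : ∀ {S : Set C(KacGlauber.Torus d, ℝ)}, IsCompact S → ∀ (T : ℝ≥0) {δ : ℝ}, 0 < δ →
      Tendsto (fun k => P k ω {w | ∃ t ≤ T, ∃ G ∈ S,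
        δ ≤ |KacGlauber.avgError (w.at t) (u t) G|}) atTop (𝓝 0) := fun hS T _ hδ =>
    KacGlauber.tendsto_measure_exists_le_avgError hd hJ_symm ha hp hp1 hωa hω hu hu1 hη'
      (fun k => hP k ω) hS T hδ
  refine ⟨fun t δ hδ => ?_, fun T hT G hG hG1 δ hδ => ?_⟩
  · refine tendsto_of_tendsto_of_tendsto_of_le_of_le tendsto_const_nhds
      (key (KacGlauber.isCompact_insert_range_smul hH.1) t (δ := δ / 4) (by positivity))
      (fun k => zero_le) fun k => measure_mono fun w hw => ?_
    by_contra hcon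
    refine absurd (KacGlauber.rho_lt_of_forall_lt hH.1 (w.at t) (hu1 t t.coe_nonneg) hδ
      fun j => ?_) (not_lt.2 hw)
    by_contra hj
    exact hcon ⟨t, le_rfl, _, Or.inr ⟨j, rfl⟩, not_lt.1 hj⟩
  -- Joint continuity makes $t\mapsto G(t,\cdot)$ a continuous curve in $C(\Lambda)$, so its range
  -- over $[0,T]$ is a compact family of test functions.
  · let g : C(Icc (0 : ℝ) T, C(KacGlauber.Torus d, ℝ)) :=
      ContinuousMap.curry ⟨fun q => G q.1 q.2, hG.comp_continuous
        (f := fun q : Icc (0 : ℝ) T × KacGlauber.Torus d => ((q.1 : ℝ), q.2)) (by fun_prop)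
        fun q => ⟨q.1.2, mem_univ _⟩⟩
    refine tendsto_of_tendsto_of_tendsto_of_le_of_le tendsto_const_nhds
      -- With $\delta/2$, off the bad event the supremum is at most $\delta/2<\delta$, whether or
      -- not it is attained.
      (key (isCompact_range g.continuous) T (half_pos hδ)) (fun k => zero_le)
      fun k => measure_mono fun w hw => ?_
    by_contra hcon
    have hle : (⨆ t : Icc (0 : ℝ≥0) T, |KacGlauber.pairing (KacGlauber.empirical (w.at t)) (G t) -
        KacGlauber.pairing (KacGlauber.density fun r => u t r) (G t)|) ≤ δ / 2 := by
      refine Real.iSup_le (fun t => ?_) (half_pos hδ).le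
      have htT : ((t : ℝ≥0) : ℝ) ∈ Icc (0 : ℝ) T := ⟨(t : ℝ≥0).coe_nonneg, t.2.2⟩
      by_contra ht
      refine hcon ⟨t, t.2.2, _, ⟨⟨_, htT⟩, rfl⟩, ?_⟩
      have e : G t = g ⟨_, htT⟩ := rfl
      rw [e, KacGlauber.pairing_empirical, KacGlauber.pairing_density
        (KacGlauber.integrable_of_continuous (u t).continuous)] at ht
      exact (not_le.1 ht).le
    have hw' : δ ≤ ⨆ t : Icc (0 : ℝ≥0) T, |KacGlauber.pairing (KacGlauber.empirical (w.at t)) (G t) -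
        KacGlauber.pairing (KacGlauber.density fun r => u t r) (G t)| := hw
    linarith
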